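/- Let $k$ be a field of prime characteristic $p$, let $N$ be a normal subgroup of a finite group $G$, and let $A$ be a $p$-permutation $N$-interior $G$-algebra. That is, $A$ is a finite-dimensional unital $k$-algebra on which $G$ acts by $k$-algebra automorphisms and which has a $P$-stable $k$-basis for every $p$-subgroup $P$ of $G$; and there is a group homomorphism $\varphi:N\to A^\times$ with ${}^g\varphi(n)=\varphi(gng^{-1})$ and ${}^na=\varphi(n)a\varphi(n)^{-1}$ for $g\in G$, $n\in N$, $a\in A$. Notation. For a subgroup $P\le G$ let $A^P$ be the algebra of $P$-fixed points, $\mathrm{Tr}_R^P:A^R\to A^P$ the relative trace for $R\le P$, $A(P)=A^P/\sum_{R<P}\mathrm{Tr}_R^P(A^R)$ the Brauer quotient, which is an $N_G(P)$-algebra, and $\mathrm{Br}_P:A^P\to A(P)$ the quotient map. A block of an algebra is a primitive idempotent of its centre. For a finite group $G$, a $p$-permutation $G$-algebra $A$ and a primitive idempotent $c$ of $A^G$: * An $(A,c,G)$-Brauer pair is a pair $(P,e)$ with $P$ a $p$-subgroup of $G$ and $e$ a block of $A(P)$ such that $\mathrm{Br}_P(c)e\ne0$. * $(R,f)\le(P,e)$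 means that $R\le P$ and that $\mathrm{Br}_R(i)f\neq 0$ for every primitive idempotent $i$ of $A^P$ with $\mathrm{Br}_P(i)e\ne0$. * Conjugation by $x\in G$ is ${}^x(P,e)=(xPx^{-1},{}^xe)$. * If $(U,f_U)$ is a maximal $(A,c,G)$-Brauer pair, the fusion system $\mathcal F_{(U,f_U)}(A,c,G)$ is the category whose objects are the $(A,c,G)$-Brauer pairs $(S,f_S)\le(U,f_U)$ (such a pair is determined by $S$), and whose morphisms $(S,f_S)\to(T,f_T)$ are the group homomorphisms $c_x:S\to T$, $u\mapsto xux^{-1}$, for $x\in G$ with ${}^x(S,f_S)\le(T,f_T)$. Now let $c\in A^G$ be a ($G$-invariant) primitive idempotent of $A^N$, and let $Q$ be a defect group of $c$ in $N$, i.e. minimal among the subgroups $R\le N$ with $c\in\mathrm{Tr}_R^N(A^R)$. Let $(Q,f_Q)$ be an $(A,c,G)$-Brauer pair such that $f_Q$ is a primitive idempotent of $A(Q)^{C_N(Q)}$, and let $H=N_G(Q,f_Q)$ be its stabilizer in $G$, so that $A(Q)$ is an $H$-algebra. For a $p$-subgroup $R$ with $Q\le R\le H$ identify $A(Q)(R)$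 with $A(R)$ by the canonical isomorphism $A(R)\to A(Q)(R)$, $\mathrm{Br}_R(a)\mapsto\mathrm{Br}^{A(Q)}_R(\mathrm{Br}_Q(a))$ $(a\in A^R)$. Let $(U,f_U)$ be a maximal $(A,c,G)$-Brauer pair with $(Q,f_Q)\le(U,f_U)$. **Theorem 3.9.** We have $U\le H$, and $(U,f_U)$ is a maximal $(A(Q),f_Q,H)$-Brauer pair. Let $\mathcal C$ be the full subcategory of $\mathcal F_{(U,f_U)}(A,c,G)$ on the pairs $(R,f_R)$ with $(Q,f_Q)\le(R,f_R)$ as $(A,c,G)$-Brauer pairs, and let $\mathcal D$ be the full subcategory of $\mathcal F_{(U,f_U)}(A(Q),f_Q,H)$ on the pairs $(R,f_R)$ with $(Q,f_Q)\le(R,f_R)$ as $(A(Q),f_Q,H)$-Brauer pairs. Then the identity functor, which sends each pair to itself and each morphism to the same group homomorphism, is a well-defined isomorphism of categories $\mathcal D\to\mathcal C$. -/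

import Mathlib

open scoped Pointwise

namespace BrauerPairs

open CategoryTheory

/-! ### Idempotents -/

/-- `e` is a primitive idempotent of the ring `R`: it is nonzero and is not the sum of two nonzero
orthogonal idempotents. -/
def IsPrimitive {R : Type*} [Ring R] (e : R) : Prop :=
  IsIdempotentElem e ∧ e ≠ 0 ∧
    ∀ a b : R, IsIdempotentElem a → IsIdempotentElem b → a * b = 0 → b * a = 0 → a + b = e →
      a = 0 ∨ b = 0

/-- `e` is a primitive idempotent of the subalgebra `B`. -/
def IsPrimitiveIn {k R : Type*} [Field k] [Ring R] [Algebra k R] (B : Subalgebra k R) (e : R) :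
    Prop :=
  ∃ h : e ∈ B, IsPrimitive (⟨e, h⟩ : B)

/-- `e` is a block of `R`: a primitive idempotent of the centre `Z(R)`. -/
def IsBlock {R : Type*} [Ring R] (e : R) : Prop :=
  ∃ z : Subring.center R, IsPrimitive z ∧ (z : R) = e

/-- In a finite dimensional algebra, if `φ i * g ≠ 0` for an idempotent `i` and a ring
homomorphism `φ`, then `φ j * g ≠ 0` for a primitive idempotent `j = i * j = j * i`. -/
theorem exists_primitive_le {k B R : Type*} [Field k] [Ring B] [Algebra k B]
    [FiniteDimensional k B] [Ring R] (φ : B →+* R) (g : R) (i : B) (hi : IsIdempotentElem i)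
    (hig : φ i * g ≠ 0) : ∃ j : B, IsPrimitive j ∧ i * j = j ∧ j * i = j ∧ φ j * g ≠ 0 := by
  let d : B → ℕ := fun j => Module.finrank k (LinearMap.range (LinearMap.mulLeft k j))
  have main : ∀ n : ℕ, ∀ i : B, d i = n → IsIdempotentElem i → φ i * g ≠ 0 →
      ∃ j : B, IsPrimitive j ∧ i * j = j ∧ j * i = j ∧ φ j * g ≠ 0 := by
    intro n
    induction n using Nat.strong_induction_on with
    | _ n ih =>
      intro i hdi hi hig
      by_cases hp : IsPrimitive i
      · exact ⟨i, hp, hi, hi, hig⟩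
      have hi0 : i ≠ 0 := by
        rintro rfl
        simp at hig
      have : ∃ a b : B, IsIdempotentElem a ∧ IsIdempotentElem b ∧ a * b = 0 ∧ b * a = 0 ∧
          a + b = i ∧ b ≠ 0 ∧ φ a * g ≠ 0 := by
        unfold IsPrimitive at hp
        push Not at hp
        obtain ⟨a, b, ha, hb, hab, hba, hs, ha0, hb0⟩ := hp hi hi0
        by_cases h : φ a * g = 0
        · refine ⟨b, a, hb, ha, hba, hab, by rw [add_comm, hs], ha0, fun h' => hig ?_⟩
          rw [← hs, map_add, add_mul, h, h', add_zero]
        · exact ⟨a, b, ha, hb, hab, hba, hs, hb0, h⟩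
      obtain ⟨a, b, ha, hb, hab, hba, hs, hb0, hg⟩ := this
      have hia : i * a = a := by rw [← hs, add_mul, ha.eq, hba, add_zero]
      have hai : a * i = a := by rw [← hs, mul_add, ha.eq, hab, add_zero]
      have hle : LinearMap.range (LinearMap.mulLeft k a) ≤
          LinearMap.range (LinearMap.mulLeft k i) := by
        rintro _ ⟨x, rfl⟩
        exact ⟨a * x, by simp [← mul_assoc, hia]⟩
      have hlt : d a < n := by
        rw [← hdi]
        refine lt_of_le_of_ne (Submodule.finrank_mono hle) fun h => hb0 ?_
        have heq := Submodule.eq_of_le_of_finrank_eq hle h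
        have hmem : i ∈ LinearMap.range (LinearMap.mulLeft k a) := by
          rw [heq]
          exact ⟨1, by simp⟩
        obtain ⟨x, hx⟩ := hmem
        have hx' : a * x = i := hx
        have : a * i = i := by rw [← hx', ← mul_assoc, ha.eq]
        have hia' : i = a := by rw [← this, hai]
        have : a + b = a := by rw [hs, hia']
        simpa using this
      obtain ⟨j, hj, h1, h2, h3⟩ := ih _ hlt a rfl ha hg
      refine ⟨j, hj, ?_, ?_, h3⟩
      · rw [← h1, ← mul_assoc, hia]
      · rw [← h2, mul_assoc, hai]
  exact main _ i rfl hi hig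

/-! ### Fixed points, relative traces and the Brauer quotient -/

section BrauerQuotient

variable (k : Type*) {G : Type*} (A : Type*) [Field k] [Group G] [Ring A] [Algebra k A]
  [MulSemiringAction G A] [SMulCommClass G k A]

/-- The algebra `A^P` of fixed points of a subgroup `P` of `G`. -/
abbrev fixed (P : Subgroup G) : Subalgebra k A := FixedPoints.subalgebra k A P

variable {k A}

theorem mem_fixed {P : Subgroup G} {a : A} : a ∈ fixed k A P ↔ ∀ g ∈ P, g • a = a :=
  ⟨fun h g hg => h ⟨g, hg⟩, fun h g => h g g.2⟩

variable (k A) in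
theorem fixed_anti {P Q : Subgroup G} (h : Q ≤ P) : fixed k A P ≤ fixed k A Q := fun _ ha =>
  mem_fixed.2 fun g hg => mem_fixed.1 ha g (h hg)

/-- The relative trace `Tr_R^P(a) = ∑ x • a`, with `x` running over representatives of `P / R`;
used for `R ≤ P` and `a ∈ A^R`. -/
noncomputable def relTrace (R P : Subgroup G) (a : A) : A :=
  ∑ᶠ x : P ⧸ R.subgroupOf P, ((Quotient.out x : P) : G) • a

theorem mk_smul_eq {R P : Subgroup G} {a : A} (ha : a ∈ fixed k A R) (x y : P)
    (h : (x : P ⧸ R.subgroupOf P) = y) : (x : G) • a = (y : G) • a := by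
  have h1 : x⁻¹ * y ∈ R.subgroupOf P := QuotientGroup.eq.1 h
  have h2 : (x : G)⁻¹ * y ∈ R := by simpa [Subgroup.mem_subgroupOf] using h1
  have h3 := mem_fixed.1 ha _ h2
  calc (x : G) • a = (x : G) • (((x : G)⁻¹ * y) • a) := by rw [h3]
    _ = (y : G) • a := by rw [smul_smul, mul_inv_cancel_left]

theorem out_smul {R P : Subgroup G} {a : A} (ha : a ∈ fixed k A R) (y : P) :
    ((Quotient.out (y : P ⧸ R.subgroupOf P) : P) : G) • a = (y : G) • a :=
  mk_smul_eq ha _ _ (Quotient.out_eq _)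

theorem smul_out {R P : Subgroup G} {a : A} (ha : a ∈ fixed k A R) (g : P)
    (x : P ⧸ R.subgroupOf P) :
    ((Quotient.out (g • x) : P) : G) • a = (g : G) • ((Quotient.out x : P) : G) • a := by
  have := out_smul ha (g * Quotient.out x)
  rw [smul_smul, ← Subgroup.coe_mul, ← this]
  congr 3
  conv_lhs => rw [← Quotient.out_eq x]
  rfl

variable (k A) in
/-- The two-sided ideal `∑_{R < P} Tr_R^P(A^R)` of `A^P`. -/
def brauerIdeal (P : Subgroup G) : Ideal (fixed k A P) :=
  Ideal.span {t | ∃ R : Subgroup G, R < P ∧ ∃ a ∈ fixed k A R, (t : A) = relTrace R P a}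

theorem exists_smul_ne {R P : Subgroup G} (h : R < P) (x : P ⧸ R.subgroupOf P) :
    ∃ g : P, g • x ≠ x := by
  obtain ⟨p, hp, hpR⟩ := SetLike.exists_of_lt h
  induction x using QuotientGroup.induction_on with
  | H y =>
    refine ⟨y * ⟨p, hp⟩ * y⁻¹, fun h' => hpR ?_⟩
    have h2 : ((y * ⟨p, hp⟩ * y⁻¹ * y : P) : P ⧸ R.subgroupOf P) = y := h'
    have h3 := QuotientGroup.eq.1 h2.symm
    simpa [Subgroup.mem_subgroupOf, mul_assoc] using h3

variable [Finite G]

theorem relTrace_mul {R P : Subgroup G} (a b : A) (hb : b ∈ fixed k A P) :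
    relTrace R P a * b = relTrace R P (a * b) := by
  unfold relTrace
  rw [finsum_mul' _ _ (Set.toFinite _)]
  refine finsum_congr fun x => ?_
  rw [smul_mul', mem_fixed.1 hb _ (Quotient.out x : P).2]

instance (P : Subgroup G) : (brauerIdeal k A P).IsTwoSided := by
  refine ⟨fun {a} b ha => ?_⟩
  refine Submodule.span_induction ?_ ?_ ?_ ?_ ha
  · rintro t ⟨R, hR, c, hc, ht⟩
    refine Ideal.subset_span ⟨R, hR, c * b, mul_mem hc (fixed_anti k A hR.le b.2), ?_⟩
    rw [← relTrace_mul _ _ b.2, ← ht]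
    rfl
  · simp
  · intro x y _ _ hx hy
    rw [add_mul]
    exact add_mem hx hy
  · intro r x _ hx
    rw [smul_eq_mul, mul_assoc]
    exact Ideal.mul_mem_left _ _ hx

variable (k A) in
/-- The Brauer quotient `A(P) = A^P / ∑_{R < P} Tr_R^P(A^R)`. -/
def BrauerQuotient (P : Subgroup G) : Type _ := fixed k A P ⧸ brauerIdeal k A P

namespace BrauerQuotient

variable (P : Subgroup G)

noncomputable instance : Ring (BrauerQuotient k A P) :=
  inferInstanceAs (Ring (fixed k A P ⧸ brauerIdeal k A P))

noncomputable instance : Algebra k (BrauerQuotient k A P) :=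
  inferInstanceAs (Algebra k (fixed k A P ⧸ brauerIdeal k A P))

end BrauerQuotient

variable (k A) in
/-- The Brauer homomorphism `Br_P : A^P → A(P)`. -/
noncomputable def br (P : Subgroup G) : fixed k A P →ₐ[k] BrauerQuotient k A P :=
  Ideal.Quotient.mkₐ k (brauerIdeal k A P)

theorem br_surjective (P : Subgroup G) : Function.Surjective (br k A P) :=
  Ideal.Quotient.mkₐ_surjective k _

theorem br_eq_zero {P : Subgroup G} {a : fixed k A P} : br k A P a = 0 ↔ a ∈ brauerIdeal k A P :=
  Ideal.Quotient.eq_zero_iff_mem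

instance [FiniteDimensional k A] (P : Subgroup G) : FiniteDimensional k (BrauerQuotient k A P) :=
  Module.Finite.of_surjective (br k A P).toLinearMap (br_surjective P)

/-- A sum over a finite `P`-set without `P`-fixed points of an equivariant function lies in the
kernel of `Br_P`. -/
theorem sum_mem_brauerIdeal (P : Subgroup G) {Ω : Type*} [Finite Ω] [MulAction P Ω] (F : Ω → A)
    (hF : ∀ (g : P) (ω : Ω), F (g • ω) = (g : G) • F ω)
    (hfix : ∀ ω : Ω, ∃ g : P, g • ω ≠ ω) (t : fixed k A P) (ht : (t : A) = ∑ᶠ ω, F ω) :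
    t ∈ brauerIdeal k A P := by
  classical
  let e := MulAction.selfEquivSigmaOrbitsQuotientStabilizer P Ω
  have := Fintype.ofFinite (MulAction.orbitRel.Quotient P Ω)
  have := Fintype.ofFinite Ω
  have key : ∀ ω : Ω, ∃ s ∈ brauerIdeal k A P,
      (s : A) = ∑ᶠ x : P ⧸ MulAction.stabilizer P ω, F (MulAction.ofQuotientStabilizer P ω x) := by
    intro ω
    set R : Subgroup G := (MulAction.stabilizer P ω).map P.subtype with hR
    have hsub : R.subgroupOf P = MulAction.stabilizer P ω :=
      Subgroup.comap_map_eq_self_of_injective P.subtype_injective _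
    have hlt : R < P := by
      refine lt_of_le_of_ne (Subgroup.map_subtype_le _) fun h => ?_
      obtain ⟨g, hg⟩ := hfix ω
      apply hg
      have : g ∈ MulAction.stabilizer P ω := by
        rw [← hsub, Subgroup.mem_subgroupOf, h]
        exact g.2
      exact this
    have hfixω : F ω ∈ fixed k A R := by
      refine mem_fixed.2 ?_
      rintro _ ⟨g, hg, rfl⟩
      have hg' : g • ω = ω := hg
      rw [Subgroup.coe_subtype, ← hF, hg']
    have hval : relTrace R P (F ω) =
        ∑ᶠ x : P ⧸ MulAction.stabilizer P ω, F (MulAction.ofQuotientStabilizer P ω x) := by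
      unfold relTrace
      rw [hsub]
      refine finsum_congr fun x => ?_
      rw [← hF]
      conv_rhs => rw [← Quotient.out_eq x]
      rfl
    have hmem : relTrace R P (F ω) ∈ fixed k A P := by
      refine mem_fixed.2 fun g hg => ?_
      rw [hval]
      have := Fintype.ofFinite (P ⧸ MulAction.stabilizer P ω)
      rw [finsum_eq_sum_of_fintype, Finset.smul_sum]
      refine Fintype.sum_equiv (MulAction.toPerm (⟨g, hg⟩ : P)) _ _ fun x => ?_
      rw [MulAction.toPerm_apply, MulAction.ofQuotientStabilizer_smul, hF]
    exact ⟨⟨_, hmem⟩, Ideal.subset_span ⟨R, hlt, _, hfixω, rfl⟩, hval⟩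
  choose s hs hsv using key
  have : t = ∑ o : MulAction.orbitRel.Quotient P Ω, s o.out := by
    apply Subtype.ext
    rw [ht, AddSubmonoidClass.coe_finsetSum]
    simp_rw [hsv]
    have := fun o : MulAction.orbitRel.Quotient P Ω =>
      Fintype.ofFinite (P ⧸ MulAction.stabilizer P o.out)
    simp_rw [finsum_eq_sum_of_fintype]
    rw [← Fintype.sum_sigma', ← Equiv.sum_comp e.symm]
    refine Fintype.sum_congr _ _ fun x => ?_
    obtain ⟨o, x⟩ := x
    induction x using Quotient.inductionOn' with
    | h g => rfl
  rw [this]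
  exact sum_mem fun o _ => hs _

/-! ### Conjugation -/

variable (k A) in
/-- For `P' = x P x⁻¹`, the map `A^P → A^P'`, `a ↦ x • a`. -/
def smulFixed (x : G) (P P' : Subgroup G) (h : ∀ g, g ∈ P ↔ x * g * x⁻¹ ∈ P') :
    fixed k A P →ₐ[k] fixed k A P' where
  toFun a := ⟨x • (a : A), mem_fixed.2 fun g hg => by
    have h1 : x⁻¹ * g * x ∈ P := by
      rw [h]
      simpa [mul_assoc] using hg
    have h2 := mem_fixed.1 a.2 _ h1
    conv_rhs => rw [← h2]
    simp [smul_smul, mul_assoc]⟩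
  map_one' := Subtype.ext (smul_one x)
  map_mul' a b := Subtype.ext (smul_mul' x (a : A) b)
  map_zero' := Subtype.ext (smul_zero x)
  map_add' a b := Subtype.ext (smul_add x (a : A) b)
  commutes' r := Subtype.ext (smul_algebraMap x r)

theorem brauerIdeal_le_comap_smulFixed (x : G) (P P' : Subgroup G)
    (h : ∀ g, g ∈ P ↔ x * g * x⁻¹ ∈ P') :
    brauerIdeal k A P ≤ (brauerIdeal k A P').comap (smulFixed k A x P P' h) := by
  refine Ideal.span_le.2 ?_
  rintro t ⟨R, hR, a, ha, ht⟩
  have hmem : ∀ g : P', x⁻¹ * g * x ∈ P := fun g => by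
    rw [h]
    simp [mul_assoc]
  let f : P' →* P :=
    { toFun := fun g => ⟨x⁻¹ * g * x, hmem g⟩
      map_one' := Subtype.ext (by simp)
      map_mul' := fun g g' => Subtype.ext (by simp [mul_assoc]) }
  let _ : MulAction P' (P ⧸ R.subgroupOf P) := MulAction.compHom _ f
  have hdef : ∀ (g : P') (ω : P ⧸ R.subgroupOf P), g • ω = f g • ω := fun _ _ => rfl
  refine sum_mem_brauerIdeal P' (Ω := P ⧸ R.subgroupOf P)
    (fun ω => x • ((Quotient.out ω : P) : G) • a) ?_ ?_ _ ?_
  · intro g ω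
    rw [hdef, smul_out ha]
    simp [f, smul_smul, mul_assoc]
  · intro ω
    obtain ⟨g, hg⟩ := exists_smul_ne hR ω
    refine ⟨⟨x * g * x⁻¹, (h _).1 g.2⟩, ?_⟩
    rw [hdef]
    convert hg using 2
    exact Subtype.ext (by simp [f, mul_assoc])
  · have : ((smulFixed k A x P P' h t : fixed k A P') : A) = x • (t : A) := rfl
    rw [this, ht]
    exact smul_finsum' x (Set.toFinite _)

variable (k A) in
/-- For `P' = x P x⁻¹`, the map `A(P) → A(P')` induced by `a ↦ x • a`. -/
noncomputable def conjHom (x : G) (P P' : Subgroup G) (h : ∀ g, g ∈ P ↔ x * g * x⁻¹ ∈ P') :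
    BrauerQuotient k A P →ₐ[k] BrauerQuotient k A P' :=
  Ideal.quotientMapₐ _ (smulFixed k A x P P' h) (brauerIdeal_le_comap_smulFixed x P P' h)

theorem conjHom_br (x : G) (P P' : Subgroup G) (h : ∀ g, g ∈ P ↔ x * g * x⁻¹ ∈ P')
    (a : fixed k A P) : conjHom k A x P P' h (br k A P a) = br k A P' (smulFixed k A x P P' h a) :=
  rfl

/-- The action of `N_G(P)` on `A(P)`. -/
noncomputable instance (P : Subgroup G) :
    MulSemiringAction (Subgroup.normalizer (P : Set G)) (BrauerQuotient k A P) where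
  smul x a := conjHom k A (x : G) P P x.2 a
  one_smul a := by
    obtain ⟨a, rfl⟩ := br_surjective P a
    exact congrArg (br k A P) (Subtype.ext (one_smul G (a : A)))
  mul_smul x y a := by
    obtain ⟨a, rfl⟩ := br_surjective P a
    exact congrArg (br k A P) (Subtype.ext (mul_smul (x : G) (y : G) (a : A)))
  smul_zero x := map_zero (conjHom k A (x : G) P P x.2)
  smul_add x := map_add (conjHom k A (x : G) P P x.2)
  smul_one x := map_one (conjHom k A (x : G) P P x.2)
  smul_mul x := map_mul (conjHom k A (x : G) P P x.2)

theorem smul_br (P : Subgroup G) (x : Subgroup.normalizer (P : Set G)) (a : fixed k A P) :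
    x • br k A P a = br k A P (smulFixed k A (x : G) P P x.2 a) := rfl

instance (P : Subgroup G) :
    SMulCommClass (Subgroup.normalizer (P : Set G)) k (BrauerQuotient k A P) where
  smul_comm x r a := map_smul (conjHom k A (x : G) P P x.2) r a

/-! ### The canonical map `A(R) → A(Q)(R)` -/

/-- The inclusion in `G` of a subgroup `H` of `N_G(Q)`. -/
def incl {Q : Subgroup G} (H : Subgroup (Subgroup.normalizer (Q : Set G))) : H →* G :=
  (Subgroup.normalizer (Q : Set G)).subtype.comp H.subtype

variable (k A) in
/-- For `Q ≤ R`, the map `A^R → A(Q)^R`, `a ↦ Br_Q(a)`. Here `R` acts on `A(Q)` as a subgroup of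
a subgroup `H` of `N_G(Q)`. -/
noncomputable def descendFixed {Q : Subgroup G} (H : Subgroup (Subgroup.normalizer (Q : Set G)))
    (R : Subgroup G) (hQR : Q ≤ R) :
    fixed k A R →ₐ[k] fixed k (BrauerQuotient k A Q) (R.comap (incl H)) :=
  ((br k A Q).comp (Subalgebra.inclusion (fixed_anti k A hQR))).codRestrict _ fun a =>
    mem_fixed.2 fun g hg => by
      change br k A Q (smulFixed k A ((g : Subgroup.normalizer (Q : Set G)) : G) Q Q
        (g : Subgroup.normalizer (Q : Set G)).2 _) = _
      refine congrArg (br k A Q) (Subtype.ext ?_)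
      exact mem_fixed.1 a.2 (incl H g) hg

theorem brauerIdeal_le_comap_descendFixed {Q : Subgroup G}
    (H : Subgroup (Subgroup.normalizer (Q : Set G)))
    (R : Subgroup G) (hQR : Q ≤ R) (hRH : R ≤ (incl H).range) :
    brauerIdeal k A R ≤
      (brauerIdeal k (BrauerQuotient k A Q) (R.comap (incl H))).comap
        (descendFixed k A H R hQR) := by
  refine Ideal.span_le.2 ?_
  rintro t ⟨T, hT, a, ha, ht⟩
  change descendFixed k A H R hQR t ∈
    brauerIdeal k (BrauerQuotient k A Q) (R.comap (incl H))
  have hnorm : ∀ r ∈ R, ∀ q, q ∈ Q ↔ r * q * r⁻¹ ∈ Q := by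
    intro r hr
    obtain ⟨h, rfl⟩ := hRH hr
    exact (h : Subgroup.normalizer (Q : Set G)).2
  by_cases hQT : Q ≤ T
  · have hx : ∀ x : R ⧸ T.subgroupOf R, ((Quotient.out x : R) : G) • a ∈ fixed k A Q := by
      intro x
      refine mem_fixed.2 fun q hq => ?_
      have h1 : ((Quotient.out x : R) : G)⁻¹ * q * (Quotient.out x : R) ∈ Q := by
        have := hnorm _ (Quotient.out x : R).2
        rw [this]
        simpa [mul_assoc] using hq
      have h2 := mem_fixed.1 ha _ (hQT h1)
      conv_rhs => rw [← h2]
      simp [smul_smul, mul_assoc]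
    let f : R.comap (incl H) →* R :=
      ((incl H).comp (Subgroup.subtype _)).codRestrict R fun g => g.2
    let _ : MulAction (R.comap (incl H)) (R ⧸ T.subgroupOf R) := MulAction.compHom _ f
    have hdef : ∀ (g : R.comap (incl H)) (ω : R ⧸ T.subgroupOf R), g • ω = f g • ω :=
      fun _ _ => rfl
    refine sum_mem_brauerIdeal (R.comap (incl H)) (Ω := R ⧸ T.subgroupOf R)
      (fun ω => br k A Q ⟨((Quotient.out ω : R) : G) • a, hx ω⟩) ?_ ?_ _ ?_
    · intro g ω
      refine congrArg (br k A Q) (Subtype.ext ?_)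
      change ((Quotient.out (g • ω) : R) : G) • a = (incl H g) • ((Quotient.out ω : R) : G) • a
      rw [hdef, smul_out ha]
      rfl
    · intro ω
      obtain ⟨g, hg⟩ := exists_smul_ne hT ω
      obtain ⟨h, hh⟩ := hRH g.2
      refine ⟨⟨h, by rw [Subgroup.mem_comap, hh]; exact g.2⟩, ?_⟩
      rw [hdef]
      convert hg using 2
      exact Subtype.ext hh
    · change br k A Q (Subalgebra.inclusion (fixed_anti k A hQR) t) = _
      have := Fintype.ofFinite (R ⧸ T.subgroupOf R)
      rw [finsum_eq_sum_of_fintype, ← map_sum]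
      congr 1
      apply Subtype.ext
      rw [AddSubmonoidClass.coe_finsetSum]
      change (t : A) = _
      rw [ht, relTrace, finsum_eq_sum_of_fintype]
  · have : descendFixed k A H R hQR t = 0 := by
      apply Subtype.ext
      change br k A Q (Subalgebra.inclusion (fixed_anti k A hQR) t) = 0
      rw [br_eq_zero]
      let f : Q →* R := Subgroup.inclusion hQR
      let _ : MulAction Q (R ⧸ T.subgroupOf R) := MulAction.compHom _ f
      have hdef : ∀ (g : Q) (ω : R ⧸ T.subgroupOf R), g • ω = f g • ω := fun _ _ => rfl
      refine sum_mem_brauerIdeal Q (Ω := R ⧸ T.subgroupOf R)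
        (fun ω => ((Quotient.out ω : R) : G) • a) ?_ ?_ _ ?_
      · intro g ω
        rw [hdef, smul_out ha]
        rfl
      · intro ω
        by_contra! hcon
        apply hQT
        intro q hq
        induction ω using QuotientGroup.induction_on with
        | H y =>
          have h1 : (y : G) * q * (y : G)⁻¹ ∈ Q := (hnorm y y.2 q).1 hq
          have h2 := hcon ⟨_, h1⟩
          rw [hdef] at h2
          have h3 : ((f ⟨_, h1⟩ * y : R) : R ⧸ T.subgroupOf R) = y := h2
          have h4 := QuotientGroup.eq.1 h3.symm
          simpa [Subgroup.mem_subgroupOf, f, mul_assoc] using h4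
      · exact ht
    rw [this]
    exact zero_mem _

variable (k A) in
/-- For `Q ≤ R ≤ H ≤ N_G(Q)`, the canonical map `A(R) → A(Q)(R)`, `Br_R(a) ↦ Br_R(Br_Q(a))` for
`a ∈ A^R`. It is an isomorphism when `A` is a `p`-permutation algebra and `R` is a `p`-group. -/
noncomputable def descendHom {Q : Subgroup G} (H : Subgroup (Subgroup.normalizer (Q : Set G)))
    (R : Subgroup G) (hQR : Q ≤ R) (hRH : R ≤ (incl H).range) :
    BrauerQuotient k A R →ₐ[k] BrauerQuotient k (BrauerQuotient k A Q) (R.comap (incl H)) :=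
  Ideal.quotientMapₐ _ (descendFixed k A H R hQR) (brauerIdeal_le_comap_descendFixed H R hQR hRH)

end BrauerQuotient

/-! ### Brauer pairs -/

section Pairs

variable (k : Type*) (G : Type*) (A : Type*) [Field k] [Group G] [Finite G] [Ring A] [Algebra k A]
  [MulSemiringAction G A] [SMulCommClass G k A]

/-- A pair `(P, e)` of a subgroup `P` of `G` and an element `e` of `A(P)`. -/
structure Pair where
  /-- the subgroup -/
  P : Subgroup G
  /-- the element of the Brauer quotient -/
  e : BrauerQuotient k A P

variable {k G A}

/-- For `c ∈ A^G`, `(P, e)` is an `(A, c, G)`-Brauer pair: `P` is a `p`-subgroup of `G`, `e` is a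
block of `A(P)`, and `Br_P(c) e ≠ 0`. -/
def IsBrauerPair (p : ℕ) (c : fixed k A (⊤ : Subgroup G)) (X : Pair k G A) : Prop :=
  IsPGroup p X.P ∧ IsBlock X.e ∧
    br k A X.P (Subalgebra.inclusion (fixed_anti k A le_top) c) * X.e ≠ 0

/-- Inclusion of Brauer pairs: `(Q, f) ≤ (P, e)` if `Q ≤ P` and `Br_Q(i) f ≠ 0` for every primitive
idempotent `i` of `A^P` such that `Br_P(i) e ≠ 0`. -/
instance : LE (Pair k G A) where
  le X Y := ∃ h : X.P ≤ Y.P, ∀ i : fixed k A Y.P, IsPrimitive i → br k A Y.P i * Y.e ≠ 0 →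
    br k A X.P (Subalgebra.inclusion (fixed_anti k A h) i) * X.e ≠ 0

/-- `X` is a maximal `(A, c, G)`-Brauer pair. -/
def IsMaximalBrauerPair (p : ℕ) (c : fixed k A (⊤ : Subgroup G)) (X : Pair k G A) : Prop :=
  IsBrauerPair p c X ∧ ∀ Y : Pair k G A, IsBrauerPair p c Y → X ≤ Y → Y = X

namespace Pair

theorem le_refl (X : Pair k G A) : X ≤ X := ⟨_root_.le_refl _, fun _ _ h => h⟩

theorem le_trans [FiniteDimensional k A] {X Y Z : Pair k G A} (h₁ : X ≤ Y) (h₂ : Y ≤ Z) :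
    X ≤ Z := by
  obtain ⟨h₁, h₁'⟩ := h₁
  obtain ⟨h₂, h₂'⟩ := h₂
  refine ⟨h₁.trans h₂, fun i hi hie => ?_⟩
  have h := h₂' i hi hie
  set i' : fixed k A Y.P := Subalgebra.inclusion (fixed_anti k A h₂) i with hi'
  have hid : IsIdempotentElem i' := hi.1.map (Subalgebra.inclusion (fixed_anti k A h₂))
  obtain ⟨j, hj, hij, hji, hjY⟩ := exists_primitive_le (k := k) (br k A Y.P).toRingHom Y.e i' hid h
  have := h₁' j hj hjY
  intro h0
  apply this
  rw [← hji, map_mul, map_mul, mul_assoc]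
  have h0' : br k A X.P (Subalgebra.inclusion (fixed_anti k A h₁) i') * X.e = 0 := h0
  rw [h0', mul_zero]

/-- The conjugate pair `ˣ(P, e) = (x P x⁻¹, ˣe)`. -/
noncomputable def conj (x : G) (X : Pair k G A) : Pair k G A where
  P := MulAut.conj x • X.P
  e := conjHom k A x X.P (MulAut.conj x • X.P)
    (fun g => by simp [Subgroup.mem_pointwise_smul_iff_inv_smul_mem, mul_assoc]) X.e

theorem ext_of_rep {X Y : Pair k G A} (h : X.P = Y.P) (a : A) (hX : a ∈ fixed k A X.P)
    (hY : a ∈ fixed k A Y.P) (hXe : X.e = br k A X.P ⟨a, hX⟩) (hYe : Y.e = br k A Y.P ⟨a, hY⟩) :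
    X = Y := by
  obtain ⟨P, e⟩ := X
  obtain ⟨P', e'⟩ := Y
  dsimp only at h hX hY hXe hYe
  subst h
  rw [hXe, hYe]

theorem exists_rep (X : Pair k G A) : ∃ (a : A) (h : a ∈ fixed k A X.P), X.e =
    br k A X.P ⟨a, h⟩ := by
  obtain ⟨a, ha⟩ := br_surjective X.P X.e
  exact ⟨a, a.2, ha.symm⟩

theorem conj_rep (x : G) (X : Pair k G A) (a : A) (h : a ∈ fixed k A X.P)
    (hX : X.e = br k A X.P ⟨a, h⟩) :
    ∃ h' : x • a ∈ fixed k A (conj x X).P, (conj x X).e = br k A (conj x X).P ⟨x • a, h'⟩ := by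
  have hh : ∀ g, g ∈ X.P ↔ x * g * x⁻¹ ∈ MulAut.conj x • X.P :=
    fun g => by simp [Subgroup.mem_pointwise_smul_iff_inv_smul_mem, mul_assoc]
  refine ⟨(smulFixed k A x X.P _ hh ⟨a, h⟩).2, ?_⟩
  change conjHom k A x X.P _ _ X.e = _
  rw [hX, conjHom_br]
  rfl

theorem one_conj (X : Pair k G A) : conj 1 X = X := by
  obtain ⟨a, h, hX⟩ := X.exists_rep
  obtain ⟨h', hX'⟩ := conj_rep 1 X a h hX
  refine ext_of_rep (by simp [conj]) _ h' (by rwa [one_smul]) hX' ?_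
  rw [hX]
  congr 2
  rw [one_smul]

theorem mul_conj (x y : G) (X : Pair k G A) : conj (x * y) X = conj x (conj y X) := by
  obtain ⟨a, h, hX⟩ := X.exists_rep
  obtain ⟨h₁, hX₁⟩ := conj_rep (x * y) X a h hX
  obtain ⟨h₂, hX₂⟩ := conj_rep y X a h hX
  obtain ⟨h₃, hX₃⟩ := conj_rep x (conj y X) _ h₂ hX₂
  refine ext_of_rep (by simp [conj, mul_smul]) _ h₁ (by rw [mul_smul]; exact h₃) hX₁ ?_
  rw [hX₃]
  congr 2
  rw [mul_smul]

theorem conj_le_conj (x : G) {X Y : Pair k G A} (h : X ≤ Y) : conj x X ≤ conj x Y := by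
  obtain ⟨h, h'⟩ := h
  have hc : ∀ (P : Subgroup G) (g : G), g ∈ P ↔ x * g * x⁻¹ ∈ MulAut.conj x • P :=
    fun P g => by simp [Subgroup.mem_pointwise_smul_iff_inv_smul_mem, mul_assoc]
  have hd : ∀ (P : Subgroup G) (g : G), g ∈ MulAut.conj x • P ↔ x⁻¹ * g * x⁻¹⁻¹ ∈ P :=
    fun P g => by simp [Subgroup.mem_pointwise_smul_iff_inv_smul_mem, mul_assoc]
  have hle : MulAut.conj x • X.P ≤ MulAut.conj x • Y.P := 
    Subgroup.pointwise_smul_le_pointwise_smul_iff.2 h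
  refine ⟨hle, fun (i : fixed k A (MulAut.conj x • Y.P)) hi hie => ?_⟩
  replace hi : IsPrimitive i := hi
  let φ := smulFixed k A x Y.P (MulAut.conj x • Y.P) (hc _)
  let ψ := smulFixed k A x⁻¹ (MulAut.conj x • Y.P) Y.P (hd _)
  let φX := smulFixed k A x X.P (MulAut.conj x • X.P) (hc _)
  have hφψ : ∀ a, φ (ψ a) = a := fun a => Subtype.ext (smul_inv_smul x (a : A))
  have hψφ : ∀ a, ψ (φ a) = a := fun a => Subtype.ext (inv_smul_smul x (a : A))
  have hφ0 : ∀ a, φ a = 0 → a = 0 := fun a ha => by rw [← hψφ a, ha, map_zero]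
  have hinj : ∀ (P : Subgroup G) (u : BrauerQuotient k A P),
      conjHom k A x P (MulAut.conj x • P) (hc _) u = 0 → u = 0 := by
    intro P u hu
    have : conjHom k A x⁻¹ (MulAut.conj x • P) P (hd _)
        (conjHom k A x P (MulAut.conj x • P) (hc _) u) = u := by
      obtain ⟨a, rfl⟩ := br_surjective P u
      exact congrArg (br k A P) (Subtype.ext (inv_smul_smul x (a : A)))
    rw [← this, hu, map_zero]
  have hprim : IsPrimitive (ψ i) := by
    refine ⟨hi.1.map ψ, fun h0 => hi.2.1 (by rw [← hφψ i, h0]; exact map_zero φ), ?_⟩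
    intro a b ha hb hab hba hs
    refine (hi.2.2 (φ a) (φ b) (ha.map φ) (hb.map φ) (by rw [← map_mul, hab, map_zero])
      (by rw [← map_mul, hba, map_zero]) (by rw [← map_add, hs, hφψ])).imp (hφ0 a) (hφ0 b)
  have h1 : br k A Y.P (ψ i) * Y.e ≠ 0 := by
    intro h0
    apply hie
    have := congrArg (conjHom k A x Y.P (MulAut.conj x • Y.P) (hc _)) h0
    rw [map_mul, conjHom_br, map_zero] at this
    have hi' := hφψ i
    change smulFixed k A x Y.P (MulAut.conj x • Y.P) (hc _) (ψ i) = i at hi'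
    rw [hi'] at this
    exact this
  have h2 := h' _ hprim h1
  intro h0
  apply h2
  apply hinj
  rw [map_mul, conjHom_br]
  have : smulFixed k A x X.P (MulAut.conj x • X.P) (hc _)
      (Subalgebra.inclusion (fixed_anti k A h) (ψ i)) =
      Subalgebra.inclusion (fixed_anti k A hle) i :=
    Subtype.ext (smul_inv_smul x (i : A))
  rw [this]
  exact h0

theorem subgroup_le {X Y : Pair k G A} (h : X ≤ Y) : X.P ≤ Y.P := h.1

/-- The stabilizer `N_G(Q, f)` of a pair `(Q, f)`, as a subgroup of `N_G(Q)`. It acts on `A(Q)`. -/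
noncomputable abbrev stab (X : Pair k G A) : Subgroup (Subgroup.normalizer (X.P : Set G)) :=
  MulAction.stabilizer (Subgroup.normalizer (X.P : Set G)) X.e

/-- `f`, as an element of `A(Q)^{N_G(Q, f)}`. -/
noncomputable def fixedElt (X : Pair k G A) :
    fixed k (BrauerQuotient k A X.P) (⊤ : Subgroup X.stab) :=
  ⟨X.e, mem_fixed.2 fun g _ => g.2⟩

theorem le_stab (X : Pair k G A) : X.P ≤ (incl X.stab).range := by
  intro q hq
  have h1 : q ∈ Subgroup.normalizer (X.P : Set G) := Subgroup.le_normalizer hq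
  refine ⟨⟨⟨q, h1⟩, ?_⟩, rfl⟩
  rw [MulAction.mem_stabilizer_iff]
  obtain ⟨a, ha, hX⟩ := X.exists_rep
  rw [hX, smul_br]
  exact congrArg (br k A X.P) (Subtype.ext (mem_fixed.1 ha q hq))

/-- For a pair `Q = (Q, f_Q)` with stabilizer `H = N_G(Q, f_Q)` and a pair `X = (R, f_R)` with
`Q ≤ R ≤ H`, the pair `(R, f_R)` regarded as a pair for the `H`-algebra `A(Q)`: the image of `f_R`
under the canonical map `A(R) → A(Q)(R)` is taken as an element of `A(Q)(R)`. -/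
noncomputable def descend (X Q : Pair k G A) (hQX : Q.P ≤ X.P) (hXH : X.P ≤ (incl Q.stab).range) :
    Pair k Q.stab (BrauerQuotient k A Q.P) where
  P := X.P.comap (incl Q.stab)
  e := descendHom k A Q.stab X.P hQX hXH X.e

end Pair

/-! ### Fusion systems -/

/-- The objects of the fusion system `F_{(U, f_U)}(A, c, G)`: the `(A, c, G)`-Brauer pairs contained
in `(U, f_U)`. When `(U, f_U)` is a Brauer pair, such a pair is determined by its subgroup of `U`. -/
structure FusionSystem (p : ℕ) (c : fixed k A (⊤ : Subgroup G)) (U : Pair k G A) where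
  /-- the underlying pair -/
  pair : Pair k G A
  isBrauerPair : IsBrauerPair p c pair
  le : pair ≤ U

namespace FusionSystem

variable {p : ℕ} {c : fixed k A (⊤ : Subgroup G)} {U : Pair k G A}

/-- The morphisms `(S, f_S) → (T, f_T)` are the group homomorphisms `S → T` of the form
`u ↦ x u x⁻¹`, where `x ∈ G` satisfies `ˣ(S, f_S) ≤ (T, f_T)`. -/
def Hom (X Y : FusionSystem p c U) : Type _ :=
  {φ : X.pair.P →* Y.pair.P //
    ∃ x : G, X.pair.conj x ≤ Y.pair ∧ ∀ u : X.pair.P, (φ u : G) = x * u * x⁻¹}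

instance [FiniteDimensional k A] : Category (FusionSystem p c U) where
  Hom X Y := Hom X Y
  id X := ⟨MonoidHom.id _, 1, by rw [Pair.one_conj]; exact X.pair.le_refl, by simp⟩
  comp {X Y Z} φ ψ := ⟨ψ.1.comp φ.1, by
    obtain ⟨x, hx, hφ⟩ := φ.2
    obtain ⟨y, hy, hψ⟩ := ψ.2
    refine ⟨y * x, ?_, fun u => ?_⟩
    · rw [Pair.mul_conj]
      exact Pair.le_trans (Pair.conj_le_conj y hx) hy
    · rw [MonoidHom.comp_apply, hψ, hφ]
      simp [mul_assoc]⟩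

/-- The full subcategory of `F_{(U, f_U)}(A, c, G)` on the pairs containing the pair `V`. -/
abbrev Above [FiniteDimensional k A] (p : ℕ) (c : fixed k A (⊤ : Subgroup G)) (U V : Pair k G A) :
    Type _ :=
  ObjectProperty.FullSubcategory (fun X : FusionSystem p c U => V ≤ X.pair)

end FusionSystem

/-- A functor which is an isomorphism of categories. -/
def IsIsomorphism {C D : Type*} [Category C] [Category D] (F : D ⥤ C) : Prop :=
  ∃ F' : C ⥤ D, F ⋙ F' = 𝟭 D ∧ F' ⋙ F = 𝟭 C

/-- Let `Q = (Q, f_Q)` and `H = N_G(Q, f_Q)`. A functor from a category of Brauer pairs for the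
`H`-algebra `A(Q)` to a category of Brauer pairs for the `G`-algebra `A` is the identity functor if
it sends every pair `(R, f_R)` to itself (with `A(Q)(R)` and `A(R)` identified by the canonical map)
and every morphism to the same map between subgroups of `G`. -/
def IsIdentityFunctor [FiniteDimensional k A] {p : ℕ} {c : fixed k A (⊤ : Subgroup G)}
    {U Q : Pair k G A} {U' Q' : Pair k Q.stab (BrauerQuotient k A Q.P)}
    (F : FusionSystem.Above p Q.fixedElt U' Q' ⥤ FusionSystem.Above p c U Q) : Prop :=
  (∀ X, ∃ (h₁ : Q.P ≤ (F.obj X).obj.pair.P) (h₂ : (F.obj X).obj.pair.P ≤ (incl Q.stab).range),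
    X.obj.pair = (F.obj X).obj.pair.descend Q h₁ h₂) ∧
  ∀ {X Y} (f : X ⟶ Y) (u : X.obj.pair.P) (v : (F.obj X).obj.pair.P),
    (v : G) = incl Q.stab u → ((F.map f).hom.1 v : G) = incl Q.stab (f.hom.1 u)

/-! ### `p`-permutation algebras, `N`-interior algebras, defect groups -/

variable (k G A) in
/-- The `G`-algebra `A` is a `p`-permutation algebra: it has a finite `P`-stable `k`-basis for every
`p`-subgroup `P` of `G`. -/
def IsPPermutation (p : ℕ) : Prop :=
  ∀ P : Subgroup G, IsPGroup p P →
    ∃ (n : ℕ) (b : Module.Basis (Fin n) k A), ∀ g ∈ P, ∀ i, ∃ j, g • b i = b j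

variable (A) in
/-- An `N`-interior structure on the `G`-algebra `A`, for `N` normal in `G`: a homomorphism
`φ : N → Aˣ` of `G`-groups which induces the action of `N` on `A`. -/
structure InteriorStructure (N : Subgroup G) [N.Normal] where
  /-- the structural homomorphism -/
  φ : N →* Aˣ
  smul_φ : ∀ (g : G) (n : N),
    g • (φ n : A) = φ ⟨g * n * g⁻¹, Subgroup.Normal.conj_mem inferInstance _ n.2 g⟩
  smul_eq : ∀ (n : N) (a : A), (n : G) • a = φ n * a * ((φ n)⁻¹ : Aˣ)

variable (k) in
/-- `Q` is a defect group in `N` of the element `c`: it is minimal among the subgroups `R` of `N`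
such that `c ∈ Tr_R^N(A^R)`. -/
def IsDefectGroup (N : Subgroup G) (c : A) (Q : Subgroup G) : Prop :=
  Minimal (fun R : Subgroup G => R ≤ N ∧ ∃ a ∈ fixed k A R, relTrace R N a = c) Q

end Pairs

end BrauerPairs

open BrauerPairs CategoryTheory

/-! Everything rests on the equality `U ⊓ N = Q`. Since `Br_U(c) ≠ 0` and `U ⊓ N` is normal in `U`,
also `Br_{U ⊓ N}(c) ≠ 0`. But `c` is a trace from `Q` to `N`, and by the Mackey argument such a
trace dies under `Br_R`, for `Q ≤ R ≤ N`, unless `R = Q` (`eq_of_br_ne_zero`). So `U`, and with it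
every pair between `Q` and `U`, normalizes `Q`, and no chain of intermediate normal inclusions is
ever needed.

For a `p`-group `R` with `Q ≤ R ≤ N_G(Q)`, a permutation basis shows that `A^R → A(Q)^R` is onto
(`descendFixed_surjective`) and that `A(R) → A(Q)(R)` is an isomorphism (`descendHom_injective`).
Primitive idempotents of `A^R` and `A(Q)^R` therefore correspond, apart from those killed by `Br_Q`.
This gives three facts: `R` fixes `f_Q` as soon as `(Q, f_Q) ≤ (R, e)` (`Pair.smul_eq_of_le`); for
`R ≤ H` this inclusion means `Br_R(f_Q) e ≠ 0` (`Pair.le_iff`), which is the condition defining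
Brauer pairs of `A(Q)` and `f_Q`; and inclusions of pairs over `Q` are the same for `A` and for
`A(Q)` (`Pair.descend_le_descend_iff`). Hence the objects agree, and maximality of `U` carries over.

For morphisms, let `ˣ(R, f_R) ≤ (S, f_S)` with both pairs above `(Q, f_Q)`. Then `ˣQ ≤ S ⊓ N = Q`,
so `ˣ(Q, f_Q)` and `(Q, f_Q)` are two pairs on `Q` below `(S, f_S)`; they coincide
(`Pair.eq_of_le_of_le`), and `x ∈ H`. Thus `G` induces no more fusion than `H`. -/

namespace BrauerPairs

/-! ### Lifting idempotents and primitivity along surjections. -/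

section Idempotents

open Polynomial in
/-- Idempotents lift along homomorphisms from a finite dimensional algebra. -/
theorem exists_idempotent_lift {k B D : Type*} [Field k] [Ring B] [Algebra k B]
    [FiniteDimensional k B] [Ring D] [Algebra k D] (f : B →ₐ[k] D) {i b : B}
    (hi : IsIdempotentElem i) (hb : IsIdempotentElem (f b)) (hl : f i * f b = f b)
    (hr : f b * f i = f b) :
    ∃ j : B, IsIdempotentElem j ∧ i * j = j ∧ j * i = j ∧ f j = f b := by
  set x : B := i * b * i with hx
  have hix : i * x = x := by rw [hx, ← mul_assoc, ← mul_assoc, hi.eq]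
  have hxi : x * i = x := by rw [hx, mul_assoc, hi.eq]
  have hfx : f x = f b := by rw [hx, map_mul, map_mul, hl, hr]
  obtain ⟨m, hm0, hm⟩ : ∃ m : k[X], m ≠ 0 ∧ aeval x m = 0 :=
    ⟨minpoly k x, minpoly.ne_zero (Algebra.IsIntegral.isIntegral x), minpoly.aeval k x⟩
  obtain ⟨w, hw, hroot⟩ := Polynomial.exists_eq_pow_rootMultiplicity_mul_and_not_dvd m hm0 1
  set s := m.rootMultiplicity 1
  -- The polynomial `h = v X w` obtained here is divisible by `X` and `w` and is `1` modulo `(X -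
  -- 1)^(s+1)`. Hence `m ∣ h² - h`, so `h(x)` is idempotent; the factor `X` places it in `iBi`. The
  -- exponent `s + 1` instead of `s` forces `h(1) = 1` even when `1` is not a root of `m`, which is
  -- what gives `h(e) = e` for `e = f b`.
  have hcop : IsCoprime ((X - C (1 : k)) ^ s * (X - C 1)) (X * w) := by
    rw [← pow_succ]
    refine IsCoprime.pow_left ?_
    refine ((prime_X_sub_C (1 : k)).irreducible.coprime_iff_not_dvd).2 fun h => ?_
    rcases (prime_X_sub_C (1 : k)).dvd_or_dvd h with h | h
    · rw [dvd_iff_isRoot] at h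
      simp at h
    · exact hroot h
  obtain ⟨u, v, huv⟩ := hcop
  set h : k[X] := v * (X * w) with hh
  have h0 : h = X * (v * w) := by rw [hh]; ring
  have h1 : h = 1 - (X - C 1) * (u * (X - C (1 : k)) ^ s) := by
    rw [hh, ← huv]; ring
  have hidem : aeval x h * aeval x h = aeval x h := by
    have h2 : h * h = h - m * (u * v * X * (X - C 1)) := by
      conv_lhs => enter [2]; rw [h1]
      rw [hh]
      conv_rhs => rw [hw]
      ring
    rw [← map_mul, h2, map_sub, map_mul (aeval x) m, hm, zero_mul, sub_zero]
  have hleft : aeval x h = x * aeval x (v * w) := by rw [h0, map_mul, aeval_X]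
  have hright : aeval x h = aeval x (v * w) * x := by rw [h0, mul_comm, map_mul, aeval_X]
  refine ⟨aeval x h, hidem, ?_, ?_, ?_⟩
  · rw [hleft, ← mul_assoc, hix]
  · rw [hright, mul_assoc, hxi]
  · rw [← aeval_algHom_apply, hfx]
    set e := f b
    have e1 : e * aeval e h = aeval e h := by
      rw [h0, map_mul, aeval_X, ← mul_assoc, hb.eq]
    rw [← e1]
    have e2 : e * (e - 1) = 0 := by rw [mul_sub, hb.eq, mul_one, sub_self]
    rw [h1, map_sub, map_mul, mul_sub, ← mul_assoc, map_sub]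
    simp [e2]

variable {k B C : Type*} [Field k] [Ring B] [Algebra k B] [FiniteDimensional k B] [Ring C]
  [Algebra k C]

/-- A summand of `f i` lifts to an idempotent below `i`, so a proper decomposition of `f i` would
decompose `i`. -/
theorem IsPrimitive.map_of_surjective {f : B →ₐ[k] C} (hf : Function.Surjective f) {i : B}
    (hi : IsPrimitive i) (h0 : f i ≠ 0) : IsPrimitive (f i) := by
  refine ⟨hi.1.map f, h0, fun a b ha hb hab hba hs => ?_⟩
  obtain ⟨a, rfl⟩ := hf a
  have hl : f i * f a = f a := by rw [← hs, add_mul, ha.eq, hba, add_zero]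
  have hr : f a * f i = f a := by rw [← hs, mul_add, ha.eq, hab, add_zero]
  obtain ⟨j, hj, hij, hji, hfj⟩ := exists_idempotent_lift f hi.1 ha hl hr
  rcases hi.2.2 j (i - j) hj
    (by rw [IsIdempotentElem, sub_mul, mul_sub, mul_sub, hi.1.eq, hij, hji, hj.eq]; abel)
    (by rw [mul_sub, hji, hj.eq, sub_self]) (by rw [sub_mul, hij, hj.eq, sub_self])
    (by abel) with h | h
  · left
    rw [← hfj, h, map_zero]
  · right
    have : f i = f a := by rw [← hfj, sub_eq_zero.1 h]
    rw [this] at hs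
    simpa using hs

theorem IsPrimitive.eq_of_mul_eq {R : Type*} [Ring R] {i j : R} (hi : IsPrimitive i)
    (hj : IsIdempotentElem j) (hij : i * j = j) (hji : j * i = j) (h0 : j ≠ 0) : j = i := by
  rcases hi.2.2 j (i - j) hj
    (by rw [IsIdempotentElem, sub_mul, mul_sub, mul_sub, hi.1.eq, hij, hji, hj.eq]; abel)
    (by rw [mul_sub, hji, hj.eq, sub_self]) (by rw [sub_mul, hij, hj.eq, sub_self])
    (by abel) with h | h
  · exact absurd h h0
  · exact (sub_eq_zero.1 h).symm

/-- The dichotomy used throughout: a primitive idempotent lies below a commuting idempotent or is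
annihilated by it. -/
theorem IsPrimitive.mul_eq_self {R : Type*} [Ring R] {i z : R} (hi : IsPrimitive i)
    (hz : IsIdempotentElem z) (hc : Commute i z) (h0 : i * z ≠ 0) : i * z = i :=
  hi.eq_of_mul_eq (hi.1.mul_of_commute hc hz) (by rw [← mul_assoc, hi.1.eq])
    (by rw [mul_assoc, ← hc.eq, ← mul_assoc, hi.1.eq]) h0

/-- An idempotent lift need not be primitive, but some primitive idempotent below it survives under
`f`; its image is a nonzero idempotent below `j`, hence equals `j`. -/
theorem IsPrimitive.exists_lift {f : B →ₐ[k] C} (hf : Function.Surjective f) {j : C}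
    (hj : IsPrimitive j) : ∃ i : B, IsPrimitive i ∧ f i = j := by
  obtain ⟨b, rfl⟩ := hf j
  obtain ⟨e, he, -, -, hfe⟩ := exists_idempotent_lift f (i := 1) (b := b) .one hj.1
    (by rw [map_one, one_mul]) (by rw [map_one, mul_one])
  obtain ⟨i, hi, h1, h2, h3⟩ := exists_primitive_le (k := k) f.toRingHom 1 e he
    (by rw [mul_one]; change f e ≠ 0; rw [hfe]; exact hj.2.1)
  refine ⟨i, hi, hj.eq_of_mul_eq (hi.1.map f) ?_ ?_ (by simpa using h3)⟩
  · rw [← hfe, ← map_mul, h1]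
  · rw [← hfe, ← map_mul, h2]

end Idempotents

/-! ### Orthogonality and transport of blocks. -/

section Blocks

variable {R S : Type*} [Ring R] [Ring S]

theorem IsBlock.mem_center {e : R} (he : IsBlock e) : e ∈ Subring.center R := by
  obtain ⟨z, -, rfl⟩ := he
  exact z.2

theorem IsBlock.isIdempotentElem {e : R} (he : IsBlock e) : IsIdempotentElem e := by
  obtain ⟨z, hz, rfl⟩ := he
  exact congrArg Subtype.val hz.1

theorem IsBlock.commute {e : R} (he : IsBlock e) (x : R) : Commute e x :=
  (Subring.mem_center_iff.1 he.mem_center x).symm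

theorem IsBlock.ne_zero {e : R} (he : IsBlock e) : e ≠ 0 := by
  obtain ⟨z, hz, rfl⟩ := he
  exact fun h => hz.2.1 (Subtype.ext h)

theorem IsBlock.mul_eq_self {e z : R} (he : IsBlock e) (hz : IsIdempotentElem z)
    (hzc : z ∈ Subring.center R) (h0 : e * z ≠ 0) : e * z = e := by
  obtain ⟨e, he, rfl⟩ := he
  have hz' : IsIdempotentElem (⟨z, hzc⟩ : Subring.center R) := Subtype.ext (by exact hz)
  exact congrArg Subtype.val (he.mul_eq_self hz'
    (mul_comm _ _) fun h => h0 (congrArg Subtype.val h))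

theorem IsBlock.eq_of_mul_ne_zero {e f : R} (he : IsBlock e) (hf : IsBlock f) (h : e * f ≠ 0) :
    e = f := by
  rw [← he.mul_eq_self hf.isIdempotentElem hf.mem_center h, he.commute,
    hf.mul_eq_self he.isIdempotentElem he.mem_center (by rwa [← he.commute])]

theorem IsBlock.map {e : R} (he : IsBlock e) (σ : R ≃+* S) : IsBlock (σ e) := by
  have hc : ∀ {R' S' : Type _} [Ring R'] [Ring S'] (σ : R' ≃+* S') (z : R'),
      z ∈ Subring.center R' → σ z ∈ Subring.center S' := by
    intro R' S' _ _ σ z hz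
    refine Subring.mem_center_iff.2 fun s => ?_
    obtain ⟨r, rfl⟩ := σ.surjective s
    rw [← map_mul, ← map_mul, Subring.mem_center_iff.1 hz]
  obtain ⟨z, hz, rfl⟩ := he
  refine ⟨⟨σ z, hc σ _ z.2⟩, ⟨Subtype.ext (by
      change σ z * σ z = σ z
      rw [← map_mul]; exact congrArg (fun x : Subring.center R => σ x) hz.1), ?_, ?_⟩, rfl⟩
  · intro h
    have h' : σ z = 0 := congrArg Subtype.val h
    exact hz.2.1 (Subtype.ext (by simpa using h'))
  · intro a b ha hb hab hba hs
    have hc' : ∀ a : Subring.center S, σ.symm a ∈ Subring.center R := by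
      intro a
      refine Subring.mem_center_iff.2 fun s => ?_
      obtain ⟨r, rfl⟩ := σ.symm.surjective s
      rw [← map_mul, ← map_mul, Subring.mem_center_iff.1 a.2]
    have key : ∀ a b c : Subring.center S, a * b = c →
        (⟨_, hc' a⟩ * ⟨_, hc' b⟩ : Subring.center R) = ⟨_, hc' c⟩ := by
      rintro a b _ rfl
      exact Subtype.ext (map_mul σ.symm (a : S) b).symm
    have h0 : ∀ a : Subring.center S, (⟨_, hc' a⟩ : Subring.center R) = 0 ↔ a = 0 := by
      intro a
      rw [Subtype.ext_iff, Subtype.ext_iff]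
      exact map_eq_zero_iff σ.symm σ.symm.injective
    have hz0 : (⟨_, hc' 0⟩ : Subring.center R) = 0 := (h0 0).2 rfl
    refine (hz.2.2 ⟨_, hc' a⟩ ⟨_, hc' b⟩ (key _ _ _ ha) (key _ _ _ hb)
      ((key _ _ _ hab).trans hz0) ((key _ _ _ hba).trans hz0) (Subtype.ext ?_)).imp
      (h0 a).1 (h0 b).1
    have : (a : S) + b = σ z := congrArg Subtype.val hs
    change σ.symm a + σ.symm b = z
    rw [← map_add, this, σ.symm_apply_apply]

end Blocks

end BrauerPairs

namespace BrauerPairs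

/-! ### The kernel of `Br_P` in coordinates. -/

section PermutationBasis

variable {k G A : Type*} [Field k] [Group G] [Ring A] [Algebra k A]
  [MulSemiringAction G A] [SMulCommClass G k A] {n : ℕ} {P : Subgroup G}

/-- A subgroup stabilizing a basis permutes the basis and the coordinates. -/
theorem exists_mulAction_basis (b : Module.Basis (Fin n) k A)
    (hb : ∀ g ∈ P, ∀ i, ∃ j, g • b i = b j) :
    ∃ _ : MulAction P (Fin n), (∀ (g : P) i, (g : G) • b i = b (g • i)) ∧
      ∀ (g : P) a i, b.repr ((g : G) • a) (g • i) = b.repr a i := by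
  choose act hact using fun g : P => hb g g.2
  let inst : MulAction P (Fin n) :=
    { smul := act
      one_smul := fun i => b.injective (by
        change b (act 1 i) = _
        rw [← hact, Subgroup.coe_one, one_smul])
      mul_smul := fun g h i => b.injective (by
        change b (act (g * h) i) = b (act g (act h i))
        rw [← hact, ← hact, ← hact, Subgroup.coe_mul, mul_smul]) }
  refine ⟨inst, hact, fun g a i => ?_⟩
  have : (b.coord (g • i)).comp (DistribSMul.toLinearMap k A (g : G)) = b.coord i := by
    refine b.ext fun j => ?_
    change b.repr ((g : G) • b j) (g • i) = b.repr (b j) i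
    have hj : (g : G) • b j = b (g • j) := hact g j
    rw [hj, b.repr_self, b.repr_self, Finsupp.single_apply, Finsupp.single_apply]
    simp
  exact LinearMap.congr_fun this a

variable [Finite G]

theorem mul_relTrace {R : Subgroup G} (a b : A) (hb : b ∈ fixed k A P) :
    b * relTrace R P a = relTrace R P (b * a) := by
  unfold relTrace
  rw [mul_finsum' _ _ (Set.toFinite _)]
  refine finsum_congr fun x => ?_
  rw [smul_mul', mem_fixed.1 hb _ (Quotient.out x : P).2]

variable {p : ℕ} [Fact p.Prime] [CharP k p]

/-- An invariant functional sends `Tr_R^P(a)` to `|P : R| l(a)`, and `p` divides the index when `R <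
P`. -/
theorem map_eq_zero_of_mem_brauerIdeal (hP : IsPGroup p P) (l : A →ₗ[k] k)
    (hl : ∀ g ∈ P, ∀ a, l (g • a) = l a) {t : fixed k A P} (ht : t ∈ brauerIdeal k A P) :
    l t = 0 := by
  -- `l` is only linear, so the induction over the ideal has to carry arbitrary left multiples.
  suffices h : ∀ r : fixed k A P, l (r * t : A) = 0 by simpa using h 1
  refine Submodule.span_induction ?_ ?_ ?_ ?_ ht
  · rintro t ⟨R, hR, a, -, ht⟩ r
    rw [ht, mul_relTrace _ _ r.2, relTrace]
    have := Fintype.ofFinite (P ⧸ R.subgroupOf P)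
    have hconst : ∀ x : P ⧸ R.subgroupOf P, l (((Quotient.out x : P) : G) • (r * a : A)) =
        l (r * a) := fun x => hl _ (Quotient.out x : P).2 _
    rw [finsum_eq_sum_of_fintype, map_sum]
    simp only [hconst]
    rw [Finset.sum_const, Finset.card_univ, ← Nat.card_eq_fintype_card]
    obtain ⟨m, hm⟩ := hP.index (R.subgroupOf P)
    have hm' : Nat.card (P ⧸ R.subgroupOf P) = p ^ m := hm
    have hm0 : m ≠ 0 := by
      rintro rfl
      rw [pow_zero, Subgroup.index_eq_one, Subgroup.subgroupOf_eq_top] at hm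
      exact absurd hR (not_lt_of_ge hm)
    rw [hm', nsmul_eq_mul, Nat.cast_pow, CharP.cast_eq_zero, zero_pow hm0, zero_mul]
  · simp
  · intro x y _ _ hx hy r
    rw [AddMemClass.coe_add, mul_add, map_add, hx, hy, add_zero]
  · intro s x _ hx r
    rw [smul_eq_mul, MulMemClass.coe_mul, ← mul_assoc]
    exact hx (r * s)

omit [Finite G] [Fact p.Prime] [CharP k p] in
theorem coord_smul (b : Module.Basis (Fin n) k A) (hb : ∀ g ∈ P, ∀ i, ∃ j, g • b i = b j)
    {i : Fin n}
    (hi : ∀ g ∈ P, g • b i = b i) (g : G) (hg : g ∈ P) (a : A) :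
    b.coord i (g • a) = b.coord i a := by
  obtain ⟨inst, h1, h2⟩ := exists_mulAction_basis b hb
  have : (⟨g, hg⟩ : P) • i = i := b.injective (by rw [← h1, hi g hg])
  have h3 := h2 ⟨g, hg⟩ a i
  rwa [this] at h3

/-- The kernel of `Br_P`, in terms of a `P`-stable basis. -/
theorem mem_brauerIdeal_iff (hP : IsPGroup p P) (b : Module.Basis (Fin n) k A)
    (hb : ∀ g ∈ P, ∀ i, ∃ j, g • b i = b j) (a : fixed k A P) :
    a ∈ brauerIdeal k A P ↔ ∀ i, (∀ g ∈ P, g • b i = b i) → b.coord i a = 0 := by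
  refine ⟨fun ha i hi => map_eq_zero_of_mem_brauerIdeal hP _ (coord_smul b hb hi) ha, fun h => ?_⟩
  obtain ⟨inst, h1, h2⟩ := exists_mulAction_basis b hb
  have hfix : ∀ i : Fin n, (∀ g : P, g • i = i) ↔ ∀ g ∈ P, g • b i = b i := fun i =>
    ⟨fun hi g hg => (h1 ⟨g, hg⟩ i).trans (congrArg b (hi _)),
      fun hi g => b.injective ((h1 g i).symm.trans (hi g g.2))⟩
  -- If the coordinates at fixed basis vectors vanish, `a` is an equivariant sum over the moved
  -- basis vectors, a `P`-set without fixed points.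
  let S : Set (Fin n) := {i | ∃ g : P, g • i ≠ i}
  have hS : ∀ (g : P) (i : Fin n), i ∈ S → g • i ∈ S := by
    rintro g i ⟨x, hx⟩
    refine ⟨g * x * g⁻¹, fun h => hx ?_⟩
    rw [smul_smul, inv_mul_cancel_right, mul_smul] at h
    exact MulAction.injective g h
  let _ : MulAction P S :=
    { smul := fun g i => ⟨g • i.1, hS g i i.2⟩
      one_smul := fun i => Subtype.ext (one_smul P i.1)
      mul_smul := fun g h i => Subtype.ext (mul_smul g h i.1) }
  refine sum_mem_brauerIdeal P (fun i : S => b.repr a i.1 • b i.1) ?_ ?_ a ?_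
  · intro g i
    change b.repr (a : A) (g • i.1) • b (g • i.1) = (g : G) • b.repr (a : A) i.1 • b i.1
    rw [smul_comm, h1]
    congr 1
    rw [← h2 g a i, mem_fixed.1 a.2 g g.2]
  · rintro ⟨i, g, hg⟩
    exact ⟨g, fun h => hg (congrArg Subtype.val h)⟩
  · classical
    conv_lhs => rw [← b.sum_repr (a : A)]
    rw [← finsum_eq_sum_of_fintype, 
      finsum_set_coe_eq_finsum_mem (f := fun i => b.repr (a : A) i • b i) S]
    refine finsum_congr fun i => ?_
    by_cases hi : i ∈ S
    · simp [hi]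
    · have : b.repr (a : A) i = 0 := h i ((hfix i).1 (by simpa [S] using hi))
      simp [hi, this]

end PermutationBasis

/-! ### The canonical isomorphism `A(R) ≃ A(Q)(R)`. -/

section Descend

variable {k G A : Type*} [Field k] [Group G] [Finite G] [Ring A] [Algebra k A]
  [MulSemiringAction G A] [SMulCommClass G k A] {p : ℕ} {Q R : Subgroup G}
  {H : Subgroup (Subgroup.normalizer (Q : Set G))}

omit [Finite G] in
theorem incl_injective : Function.Injective (incl H) :=
  (Subgroup.subtype_injective _).comp (Subgroup.subtype_injective _)

omit [Finite G] in
theorem normalizes_of_le_range (hRH : R ≤ (incl H).range) {r : G} (hr : r ∈ R) (q : G) :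
    q ∈ Q ↔ r * q * r⁻¹ ∈ Q := by
  obtain ⟨h, rfl⟩ := hRH hr
  exact (h : Subgroup.normalizer (Q : Set G)).2 q

theorem smul_br_eq (h : H) (a : fixed k A Q) (a' : fixed k A Q)
    (haa : (a' : A) = incl H h • (a : A)) :
    h • br k A Q a = br k A Q a' :=
  congrArg (br k A Q) (Subtype.ext haa.symm)

theorem descendHom_br (hQR : Q ≤ R) (hRH : R ≤ (incl H).range) (a : fixed k A R) :
    descendHom k A H R hQR hRH (br k A R a) =
      br k (BrauerQuotient k A Q) (R.comap (incl H)) (descendFixed k A H R hQR a) := rfl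

theorem coe_descendFixed (hQR : Q ≤ R) (a : fixed k A R) :
    (descendFixed k A H R hQR a : BrauerQuotient k A Q) =
      br k A Q (Subalgebra.inclusion (fixed_anti k A hQR) a) := rfl

variable [Fact p.Prime] [CharP k p]

/-- `Br_Q(a)` depends only on the coordinates of `a` at the `Q`-fixed vectors of an `R`-stable
basis. If the class is `R`-fixed, these coordinates are constant on `R`-orbits, so discarding all
the others turns `a` into an `R`-fixed representative. -/
theorem descendFixed_surjective (hA : IsPPermutation k G A p) (hR : IsPGroup p R) (hQR : Q ≤ R)
    (hRH : R ≤ (incl H).range) : Function.Surjective (descendFixed k A H R hQR) := by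
  classical
  rintro ⟨y, hy⟩
  obtain ⟨a, rfl⟩ := br_surjective Q y
  obtain ⟨n, b, hb⟩ := hA R hR
  have hbQ : ∀ g ∈ Q, ∀ i, ∃ j, g • b i = b j := fun g hg => hb g (hQR hg)
  obtain ⟨inst, h1, h2⟩ := exists_mulAction_basis b hb
  let D : Fin n → Prop := fun i => ∀ g ∈ Q, g • b i = b i
  have hD1 : ∀ (g : R) i, D i → D (g • i) := by
    intro g i hi q hq
    have h3 : ((g⁻¹ : R) : G) * q * ((g⁻¹ : R) : G)⁻¹ ∈ Q :=
      (normalizes_of_le_range hRH (g⁻¹ : R).2 q).1 hq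
    have h4 := hi _ h3
    rw [← h1]
    conv_rhs => rw [← h4]
    simp [smul_smul, mul_assoc]
  have hD : ∀ (g : R) i, D (g • i) ↔ D i := fun g i =>
    ⟨fun h => by simpa using hD1 g⁻¹ _ h, hD1 g i⟩
  -- `g • a` and `a` have the same image under `Br_Q`, so they have the same coordinates at
  -- `Q`-fixed basis vectors.
  have hinv : ∀ (g : R) i, D i → b.repr (a : A) (g • i) = b.repr (a : A) i := by
    intro g i hi
    obtain ⟨h, hh⟩ := hRH g.2
    have hmem : (g : G) • (a : A) ∈ fixed k A Q := by
      refine mem_fixed.2 fun q hq => ?_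
      have h3 : ((g⁻¹ : R) : G) * q * ((g⁻¹ : R) : G)⁻¹ ∈ Q :=
        (normalizes_of_le_range hRH (g⁻¹ : R).2 q).1 hq
      have h4 := mem_fixed.1 a.2 _ h3
      conv_rhs => rw [← h4]
      simp [smul_smul, mul_assoc]
    have h3 : br k A Q ⟨_, hmem⟩ = br k A Q a := by
      rw [← smul_br_eq h a ⟨_, hmem⟩ (by rw [hh])]
      exact mem_fixed.1 hy h (by rw [Subgroup.mem_comap, hh]; exact g.2)
    rw [← sub_eq_zero, ← map_sub, br_eq_zero,
      mem_brauerIdeal_iff (hR.to_le hQR) b hbQ] at h3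
    have h4 := h3 (g • i) ((hD g i).2 hi)
    rw [AddSubgroupClass.coe_sub, map_sub, sub_eq_zero] at h4
    exact h4.symm.trans (h2 g a i)
  set a' : A := b.equivFun.symm fun i => if D i then b.repr (a : A) i else 0 with ha'
  have hrepr : ∀ i, b.repr a' i = if D i then b.repr (a : A) i else 0 := fun i => by
    rw [← b.equivFun_apply, ha', b.equivFun.apply_symm_apply]
  have hmem : a' ∈ fixed k A R := by
    refine mem_fixed.2 fun g hg => b.ext_elem fun j => ?_
    obtain ⟨i, rfl⟩ := MulAction.surjective (⟨g, hg⟩ : R) j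
    refine (h2 ⟨g, hg⟩ a' i).trans ?_
    rw [hrepr, hrepr]
    by_cases hi : D i
    · rw [if_pos hi, if_pos ((hD _ i).2 hi), hinv _ i hi]
    · rw [if_neg hi, if_neg (by rwa [hD])]
  refine ⟨⟨a', hmem⟩, Subtype.ext ?_⟩
  rw [coe_descendFixed, ← sub_eq_zero, ← map_sub, br_eq_zero,
    mem_brauerIdeal_iff (hR.to_le hQR) b hbQ]
  intro i hi
  rw [AddSubgroupClass.coe_sub, map_sub, sub_eq_zero]
  exact (hrepr i).trans (if_pos hi)

/-- The coordinate at an `R`-fixed basis vector vanishes on the kernel of `Br_Q`, hence descends to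
an `R`-invariant functional on `A(Q)`, which kills the Brauer ideal there. Arguing with functionals
avoids constructing a permutation basis of `A(Q)`. -/
theorem descendHom_injective (hA : IsPPermutation k G A p) (hR : IsPGroup p R) (hQR : Q ≤ R)
    (hRH : R ≤ (incl H).range) : Function.Injective (descendHom k A H R hQR hRH) := by
  rw [injective_iff_map_eq_zero]
  intro u hu
  obtain ⟨a, rfl⟩ := br_surjective R u
  rw [descendHom_br, br_eq_zero] at hu
  obtain ⟨n, b, hb⟩ := hA R hR
  rw [br_eq_zero, mem_brauerIdeal_iff hR b hb]
  intro i hi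
  -- A linear section of `Br_Q`; by `hl` the functional `l` does not depend on its choice.
  obtain ⟨s, hs⟩ := (br k A Q).toLinearMap.exists_rightInverse_of_surjective
    (LinearMap.range_eq_top.2 (br_surjective Q))
  let l : BrauerQuotient k A Q →ₗ[k] k :=
    (b.coord i).comp ((fixed k A Q).val.toLinearMap.comp s)
  have hl : ∀ a : fixed k A Q, l (br k A Q a) = b.coord i a := by
    intro a
    have h1 : br k A Q (s (br k A Q a) - a) = 0 := by
      rw [map_sub, sub_eq_zero]
      exact LinearMap.congr_fun hs (br k A Q a)
    rw [br_eq_zero, mem_brauerIdeal_iff (hR.to_le hQR) b fun g hg => hb g (hQR hg)] at h1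
    have h2 := h1 i fun g hg => hi g (hQR hg)
    rwa [AddSubgroupClass.coe_sub, map_sub, sub_eq_zero] at h2
  have h3 := map_eq_zero_of_mem_brauerIdeal
    (hR.comap_of_injective (incl H) incl_injective) l ?_ hu
  · rwa [coe_descendFixed, hl] at h3
  · intro h hh y
    obtain ⟨a, rfl⟩ := br_surjective Q y
    rw [smul_br_eq h a (smulFixed k A (incl H h) Q Q (h : Subgroup.normalizer (Q : Set G)).2 a) rfl,
      hl, hl]
    exact coord_smul b hb hi _ hh _

theorem descendHom_surjective (hA : IsPPermutation k G A p) (hR : IsPGroup p R) (hQR : Q ≤ R)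
    (hRH : R ≤ (incl H).range) : Function.Surjective (descendHom k A H R hQR hRH) := by
  intro y
  obtain ⟨y, rfl⟩ := br_surjective _ y
  obtain ⟨a, rfl⟩ := descendFixed_surjective hA hR hQR hRH y
  exact ⟨br k A R a, rfl⟩

/-- For `Q ⊴ R ≤ H` with `R` a `p`-group, the canonical isomorphism `A(R) ≃ A(Q)(R)`. -/
noncomputable def descendEquiv (hA : IsPPermutation k G A p) (hR : IsPGroup p R) (hQR : Q ≤ R)
    (hRH : R ≤ (incl H).range) : BrauerQuotient k A R ≃ₐ[k]
      BrauerQuotient k (BrauerQuotient k A Q) (R.comap (incl H)) :=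
  AlgEquiv.ofBijective (descendHom k A H R hQR hRH)
    ⟨descendHom_injective hA hR hQR hRH, descendHom_surjective hA hR hQR hRH⟩

end Descend

end BrauerPairs

/-! ### Orbit sums of blocks, and inclusion of pairs tested in `A(Q)`. -/

namespace BrauerPairs

theorem IsBlock.smul {M R : Type*} [Group M] [Ring R] [MulSemiringAction M R] {e : R}
    (he : IsBlock e) (g : M) : IsBlock (g • e) :=
  he.map (MulSemiringAction.toRingEquiv M R g)

/-- If the block `e` is not fixed by the finite group `P`, then the sum of its conjugates is a
central idempotent which lies in the kernel of the Brauer homomorphism. -/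
theorem exists_orbit_sum {k G B : Type*} [Field k] [Group G] [Finite G] [Ring B] [Algebra k B]
    [MulSemiringAction G B] [SMulCommClass G k B] (P : Subgroup G) {e : B} (he : IsBlock e)
    (hne : ∃ g ∈ P, g • e ≠ e) :
    ∃ t ∈ brauerIdeal k B P, IsIdempotentElem t ∧ (∀ s, Commute s t) ∧ (t : B) * e = e := by
  classical
  have : Finite (MulAction.orbit P e) := (Set.finite_range _).to_subtype
  have := Fintype.ofFinite (MulAction.orbit P e)
  have hblock : ∀ w : MulAction.orbit P e, IsBlock (w : B) := by
    rintro ⟨_, g, rfl⟩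
    exact he.smul g
  set s : B := ∑ w : MulAction.orbit P e, (w : B) with hs
  have hsw : ∀ w : MulAction.orbit P e, s * w = w := by
    intro w
    rw [hs, Finset.sum_mul, Finset.sum_eq_single w]
    · exact (hblock w).isIdempotentElem
    · intro v _ hv
      by_contra h
      exact hv (Subtype.ext ((hblock v).eq_of_mul_ne_zero (hblock w) h))
    · simp
  have hmem : s ∈ fixed k B P := by
    refine mem_fixed.2 fun g hg => ?_
    rw [hs, Finset.smul_sum]
    exact Fintype.sum_equiv (MulAction.toPerm (⟨g, hg⟩ : P)) _ _ fun w => rfl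
  refine ⟨⟨s, hmem⟩, ?_, Subtype.ext ?_, fun r => Subtype.ext ?_,
    hsw ⟨e, MulAction.mem_orbit_self e⟩⟩
  · refine sum_mem_brauerIdeal P (fun w : MulAction.orbit P e => (w : B)) (fun _ _ => rfl) ?_ _
      (finsum_eq_sum_of_fintype _).symm
    -- The set is a single orbit: if `g` moves `e`, then `x g x⁻¹` moves `x • e`.
    rintro ⟨_, x, rfl⟩
    obtain ⟨g, hg, hge⟩ := hne
    refine ⟨x * ⟨g, hg⟩ * x⁻¹, fun h => hge ?_⟩
    have h1 : (x * ⟨g, hg⟩ * x⁻¹) • x • e = x • e := congrArg Subtype.val h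
    rw [smul_smul, inv_mul_cancel_right, mul_smul] at h1
    exact MulAction.injective x h1
  · change s * s = s
    conv_lhs => enter [2]; rw [hs]
    rw [Finset.mul_sum]
    simp only [hsw]
    exact hs.symm
  · change (r : B) * s = s * r
    rw [hs, Finset.mul_sum, Finset.sum_mul]
    exact Finset.sum_congr rfl fun w _ => ((hblock w).commute _).symm

section

variable {k G A : Type*} [Field k] [Group G] [Finite G] [Ring A] [Algebra k A]
  [FiniteDimensional k A] [MulSemiringAction G A] [SMulCommClass G k A] {p : ℕ}

theorem Pair.exists_primitive (Y : Pair k G A) (hY : Y.e ≠ 0) :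
    ∃ i : fixed k A Y.P, IsPrimitive i ∧ br k A Y.P i * Y.e ≠ 0 := by
  obtain ⟨i, hi, -, -, h⟩ := exists_primitive_le (k := k) (br k A Y.P).toRingHom Y.e 1 .one
    (by simpa using hY)
  exact ⟨i, hi, h⟩

variable [Fact p.Prime] [CharP k p]

/-- If `(Q, f) ≤ (R, e)` and `R` normalizes `Q`, then `R` fixes `f`. -/
theorem Pair.smul_eq_of_le (hA : IsPPermutation k G A p) {X Y : Pair k G A} (hX : IsBlock X.e)
    (hY : Y.e ≠ 0) (hYp : IsPGroup p Y.P) {H : Subgroup (Subgroup.normalizer (X.P : Set G))}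
    (hYH : Y.P ≤ (incl H).range) (hXY : X ≤ Y) (h : H) (hh : incl H h ∈ Y.P) : h • X.e = X.e := by
  by_contra hne
  -- Let `t` be the orbit sum of `f = X.e`, and let `j = Br_Q(i)`, which is primitive in `A(Q)^R`.
  -- Since `j f ≠ 0` and `t f = f`, also `j t ≠ 0`, so `j = j t` lies in the kernel of `Br_R`. This
  -- contradicts `Br_R(i) ≠ 0`.
  obtain ⟨t, ht, htt, htc, hte⟩ := exists_orbit_sum (k := k) (Y.P.comap (incl H)) hX ⟨h, hh, hne⟩
  obtain ⟨i, hi, hiY⟩ := Y.exists_primitive hY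
  obtain ⟨hQR, hle⟩ := hXY
  have hiX := hle i hi hiY
  set j := descendFixed k A H Y.P hQR i with hj
  have hbj : br k (BrauerQuotient k A X.P) (Y.P.comap (incl H)) j ≠ 0 := by
    rw [hj, ← descendHom_br hQR hYH, Ne,
      map_eq_zero_iff _ (descendHom_injective hA hYp hQR hYH)]
    exact left_ne_zero_of_mul hiY
  have hj0 : j ≠ 0 := fun h0 => hbj (by rw [h0, map_zero])
  have hjp : IsPrimitive j :=
    hi.map_of_surjective (descendFixed_surjective hA hYp hQR hYH) hj0
  have hjt : j * t = j := by
    refine hjp.mul_eq_self htt (htc j) fun h0 => hiX ?_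
    have h1 : (j : BrauerQuotient k A X.P) * t = 0 := congrArg Subtype.val h0
    rw [← hte, ← mul_assoc]
    change (j : BrauerQuotient k A X.P) * t * X.e = 0
    rw [h1, zero_mul]
  apply hbj
  rw [← hjt, map_mul, br_eq_zero.2 ht, mul_zero]

section

variable {X Y : Pair k G A}

/-- For `Q ⊴ R ≤ N_G(Q, f)`: `(Q, f) ≤ (R, e)` if and only if `Br_R(f) e ≠ 0`. -/
theorem Pair.le_iff (hA : IsPPermutation k G A p) (hX : IsBlock X.e) (hY : IsBlock Y.e)
    (hYp : IsPGroup p Y.P) (hQR : X.P ≤ Y.P) (hYH : Y.P ≤ (incl X.stab).range) :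
    X ≤ Y ↔ br k (BrauerQuotient k A X.P) (Y.P.comap (incl X.stab))
      (Subalgebra.inclusion (fixed_anti k _ le_top) X.fixedElt) *
        descendHom k A X.stab Y.P hQR hYH Y.e ≠ 0 := by
  set z : fixed k (BrauerQuotient k A X.P) (Y.P.comap (incl X.stab)) :=
    Subalgebra.inclusion (fixed_anti k _ le_top) X.fixedElt with hz
  have hzval : (z : BrauerQuotient k A X.P) = X.e := rfl
  have hzi : IsIdempotentElem z := Subtype.ext hX.isIdempotentElem
  have hzc : ∀ s, Commute s z := fun s => Subtype.ext (hX.commute _).symm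
  have hbz : br k (BrauerQuotient k A X.P) _ z ∈ Subring.center _ := by
    refine Subring.mem_center_iff.2 fun y => ?_
    obtain ⟨y, rfl⟩ := br_surjective _ y
    rw [← map_mul, ← map_mul, hzc]
  have hsurj := descendFixed_surjective hA hYp hQR hYH
  have hinj := descendHom_injective hA hYp hQR hYH
  have hY' : IsBlock (descendHom k A X.stab Y.P hQR hYH Y.e) :=
    hY.map (descendEquiv hA hYp hQR hYH).toRingEquiv
  have key : ∀ i : fixed k A Y.P, br k A Y.P i * Y.e ≠ 0 →
      br k (BrauerQuotient k A X.P) _ (descendFixed k A X.stab Y.P hQR i) *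
        descendHom k A X.stab Y.P hQR hYH Y.e ≠ 0 := by
    intro i hi
    rwa [← descendHom_br hQR hYH, ← map_mul, Ne, map_eq_zero_iff _ hinj]
  constructor
  -- The primitive idempotent `j = Br_Q(i)` is not killed by `f`, so `j = j f`, and `Br_R(f) e = 0`
  -- would give `Br_R(j) e = 0`.
  · rintro ⟨_, hle⟩ h0
    obtain ⟨i, hi, hiY⟩ := Y.exists_primitive hY.ne_zero
    have hiX := hle i hi hiY
    have hj := key i hiY
    set j := descendFixed k A X.stab Y.P hQR i
    have hj0 : j ≠ 0 := fun h => hj (by rw [h, map_zero, zero_mul])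
    have hjz : j * z = j := (hi.map_of_surjective hsurj hj0).mul_eq_self hzi (hzc j) fun h =>
      hiX (congrArg Subtype.val h)
    apply hj
    rw [← hjz, map_mul, mul_assoc, h0, mul_zero]
  -- Conversely, the central idempotent `Br_R(f)` does not kill the block `e`, hence contains it;
  -- then `j f = 0` would force `Br_R(j) e = 0`.
  · intro h0
    refine ⟨hQR, fun i hi hiY h => key i hiY ?_⟩
    have hjz : descendFixed k A X.stab Y.P hQR i * z = 0 := Subtype.ext h
    have h1 := hY'.mul_eq_self (hzi.map (br k (BrauerQuotient k A X.P) _)) hbz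
      (by rwa [(hY'.commute _).eq])
    rw [← h1, (hY'.commute _).eq, ← mul_assoc, ← map_mul, hjz, map_zero, zero_mul]

end

/-! ### Descent of pairs from `A` to `A(Q)`: order, Brauer condition, conjugation. -/

section

variable {Q X Y : Pair k G A}

omit [Finite G] in
theorem comap_incl_le_comap_incl {R : Subgroup G} {H : Subgroup (Subgroup.normalizer (R : Set G))}
    {S T : Subgroup G} (hS : S ≤ (incl H).range) :
    S.comap (incl H) ≤ T.comap (incl H) ↔ S ≤ T := by
  refine ⟨fun h s hs => ?_, fun h => Subgroup.comap_mono h⟩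
  obtain ⟨g, rfl⟩ := hS hs
  exact h hs

/-- The identification of pairs for `A` containing `Q` with pairs for `A(Q)` preserves and reflects
inclusion. -/
theorem Pair.descend_le_descend_iff (hA : IsPPermutation k G A p) (hYp : IsPGroup p Y.P)
    (hX : Q.P ≤ X.P) (hXH : X.P ≤ (incl Q.stab).range) (hY : Q.P ≤ Y.P)
    (hYH : Y.P ≤ (incl Q.stab).range) :
    X.descend Q hX hXH ≤ Y.descend Q hY hYH ↔ X ≤ Y := by
  -- By injectivity of the canonical map, `i` and its image in `A(Q)^Z` satisfy the same
  -- nonvanishing condition. It remains to push primitive idempotents forward in one direction and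
  -- lift them in the other.
  have hkey : ∀ (Z : Pair k G A) (hZp : IsPGroup p Z.P) (hZ : Q.P ≤ Z.P)
      (hZH : Z.P ≤ (incl Q.stab).range) (i : fixed k A Z.P),
      br k (BrauerQuotient k A Q.P) _ (descendFixed k A Q.stab Z.P hZ i) *
        descendHom k A Q.stab Z.P hZ hZH Z.e ≠ 0 ↔ br k A Z.P i * Z.e ≠ 0 := by
    intro Z hZp hZ hZH i
    rw [← descendHom_br hZ hZH, ← map_mul, Ne,
      map_eq_zero_iff _ (descendHom_injective hA hZp hZ hZH)]
  constructor
  · rintro ⟨h, h'⟩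
    have hXY : X.P ≤ Y.P := (comap_incl_le_comap_incl hXH).1 h
    refine ⟨hXY, fun i hi hiY => ?_⟩
    rw [← hkey X (hYp.to_le hXY) hX hXH]
    have h1 := (hkey Y hYp hY hYH i).2 hiY
    refine h' _ (hi.map_of_surjective (descendFixed_surjective hA hYp hY hYH) fun h0 => h1 ?_) h1
    rw [h0, map_zero, zero_mul]
  · rintro ⟨hXY, h'⟩
    refine ⟨(comap_incl_le_comap_incl hXH).2 hXY, fun j hj hjY => ?_⟩
    obtain ⟨i, hi, hij⟩ := hj.exists_lift (descendFixed_surjective hA hYp hY hYH)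
    subst hij
    exact (hkey X (hYp.to_le hXY) hX hXH _).2 (h' i hi ((hkey Y hYp hY hYH i).1 hjY))

/-- The pairs `(R, e)` for `A` with `Q ≤ (R, e)` are the Brauer pairs for `A(Q)` and `f_Q`. -/
theorem Pair.isBrauerPair_descend_iff (hA : IsPPermutation k G A p)
    {c : fixed k A (⊤ : Subgroup G)} (hQ : IsBlock Q.e)
    (hcQ : br k A Q.P (Subalgebra.inclusion (fixed_anti k A le_top) c) * Q.e = Q.e)
    (hY : Q.P ≤ Y.P) (hYH : Y.P ≤ (incl Q.stab).range) :
    IsBrauerPair p Q.fixedElt (Y.descend Q hY hYH) ↔ IsBrauerPair p c Y ∧ Q ≤ Y := by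
  have hp : IsPGroup p (Y.P.comap (incl Q.stab)) ↔ IsPGroup p Y.P := by
    refine ⟨fun h => ?_, fun h => h.comap_of_injective _ incl_injective⟩
    have := h.map (incl Q.stab)
    rwa [Subgroup.map_comap_eq_self hYH] at this
  constructor
  · rintro ⟨h1, h2, h3⟩
    have h1' := hp.1 h1
    let σ := (descendEquiv hA h1' hY hYH).toRingEquiv
    have h2' : IsBlock Y.e := by
      have h4 : IsBlock (σ.symm (σ Y.e)) := IsBlock.map h2 σ.symm
      rwa [σ.symm_apply_apply] at h4
    have hle : Q ≤ Y := (Pair.le_iff hA hQ h2' h1' hY hYH).2 h3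
    refine ⟨⟨h1', h2', fun h0 => h3 ?_⟩, hle⟩
    -- As `f_Q` lies below `Br_Q(c)`, a block not killed by `Br_R(f_Q)` is not killed by `Br_R(c)`.
    have hcz : descendFixed k A Q.stab Y.P hY (Subalgebra.inclusion (fixed_anti k A le_top) c) *
        Subalgebra.inclusion (fixed_anti k _ le_top) Q.fixedElt =
          Subalgebra.inclusion (fixed_anti k _ le_top) Q.fixedElt := Subtype.ext hcQ
    change br k (BrauerQuotient k A Q.P) (Y.P.comap (incl Q.stab))
      (Subalgebra.inclusion (fixed_anti k _ le_top) Q.fixedElt) *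
        descendHom k A Q.stab Y.P hY hYH Y.e = 0
    have hY' : IsBlock (descendHom k A Q.stab Y.P hY hYH Y.e) := h2
    rw [← hcz, map_mul, mul_assoc, ← (hY'.commute _).eq, ← mul_assoc, ← descendHom_br hY hYH,
      ← map_mul, h0, map_zero, zero_mul]
  · rintro ⟨⟨h1, h2, -⟩, hle⟩
    exact ⟨hp.2 h1, h2.map (descendEquiv hA h1 hY hYH).toRingEquiv,
      (Pair.le_iff hA hQ h2 h1 hY hYH).1 hle⟩

omit [FiniteDimensional k A] in
/-- Every pair for `A(Q)` whose subgroup contains `Q` comes from a pair for `A`. -/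
theorem Pair.exists_descend_eq (hA : IsPPermutation k G A p)
    (Y : Pair k Q.stab (BrauerQuotient k A Q.P)) (hY : IsPGroup p Y.P)
    (hQY : Q.P.comap (incl Q.stab) ≤ Y.P) :
    ∃ (X : Pair k G A) (h₁ : Q.P ≤ X.P) (h₂ : X.P ≤ (incl Q.stab).range),
      Y = X.descend Q h₁ h₂ := by
  obtain ⟨P, e⟩ := Y
  obtain ⟨R, h₁, h₂, rfl⟩ : ∃ R : Subgroup G, Q.P ≤ R ∧ R ≤ (incl Q.stab).range ∧
      P = R.comap (incl Q.stab) := by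
    refine ⟨P.map (incl Q.stab), ?_, Subgroup.map_le_range _ _,
      (Subgroup.comap_map_eq_self_of_injective incl_injective P).symm⟩
    exact (Subgroup.map_comap_eq_self Q.le_stab).ge.trans (Subgroup.map_mono hQY)
  have hR : IsPGroup p R := by
    have := hY.map (incl Q.stab)
    rwa [Subgroup.map_comap_eq_self h₂] at this
  obtain ⟨e, rfl⟩ := descendHom_surjective hA hR h₁ h₂ e
  exact ⟨⟨R, e⟩, h₁, h₂, rfl⟩

omit [FiniteDimensional k A] in
theorem Pair.descend_injective (hA : IsPPermutation k G A p) (hXp : IsPGroup p X.P)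
    (hX : Q.P ≤ X.P) (hXH : X.P ≤ (incl Q.stab).range) (hY : Q.P ≤ Y.P)
    (hYH : Y.P ≤ (incl Q.stab).range) (h : X.descend Q hX hXH = Y.descend Q hY hYH) : X = Y := by
  have hP : X.P = Y.P := by
    have h' : X.P.comap (incl Q.stab) = Y.P.comap (incl Q.stab) := congrArg Pair.P h
    exact le_antisymm ((comap_incl_le_comap_incl hXH).1 h'.le)
      ((comap_incl_le_comap_incl hYH).1 h'.ge)
  obtain ⟨P, e⟩ := X
  obtain ⟨P', e'⟩ := Y
  dsimp only at hP
  subst hP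
  have h' : descendHom k A Q.stab P hX hXH e = descendHom k A Q.stab P hX hXH e' := by
    simpa [Pair.descend] using h
  rw [descendHom_injective hA hXp hX hXH h']

omit [FiniteDimensional k A] [Fact p.Prime] [CharP k p] in
theorem incl_stab_mul_mem (h : Q.stab) {q : G} :
    q ∈ Q.P ↔ incl Q.stab h * q * (incl Q.stab h)⁻¹ ∈ Q.P :=
  (h : Subgroup.normalizer (Q.P : Set G)).2 q

omit [FiniteDimensional k A] [Fact p.Prime] [CharP k p] in
theorem Pair.le_conj_incl (h : Q.stab) (hX : Q.P ≤ X.P) : Q.P ≤ (X.conj (incl Q.stab h)).P := by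
  intro q hq
  have h1 := (incl_stab_mul_mem h⁻¹).1 hq
  refine Subgroup.mem_pointwise_smul_iff_inv_smul_mem.2 (hX ?_)
  simpa using h1

omit [FiniteDimensional k A] [Fact p.Prime] [CharP k p] in
theorem Pair.conj_incl_le (h : Q.stab) (hXH : X.P ≤ (incl Q.stab).range) :
    (X.conj (incl Q.stab h)).P ≤ (incl Q.stab).range := by
  intro x hx
  obtain ⟨y, hy⟩ := hXH (Subgroup.mem_pointwise_smul_iff_inv_smul_mem.1 hx)
  refine ⟨h * y * h⁻¹, ?_⟩
  rw [map_mul, map_mul, hy]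
  simp [mul_assoc]

omit [FiniteDimensional k A] [Fact p.Prime] [CharP k p] in
-- If `a` represents the block of `X`, both sides are represented by `Br_Q(h • a)`. Comparing
-- representatives avoids transport between Brauer quotients of subgroups that are only
-- propositionally equal.
theorem Pair.conj_descend (h : Q.stab) (hX : Q.P ≤ X.P) (hXH : X.P ≤ (incl Q.stab).range) :
    (X.descend Q hX hXH).conj h =
      (X.conj (incl Q.stab h)).descend Q (le_conj_incl h hX) (conj_incl_le h hXH) := by
  obtain ⟨a, ha, hXa⟩ := X.exists_rep
  obtain ⟨ha', hXa'⟩ := conj_rep (incl Q.stab h) X a ha hXa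
  have hD : (X.descend Q hX hXH).e = br k _ (X.P.comap (incl Q.stab))
      ⟨_, (descendFixed k A Q.stab X.P hX ⟨a, ha⟩).2⟩ := by
    change descendHom k A Q.stab X.P hX hXH X.e = _
    rw [hXa]
    rfl
  obtain ⟨hc, hDc⟩ := conj_rep h (X.descend Q hX hXH) _ _ hD
  have hD' : ((X.conj (incl Q.stab h)).descend Q (le_conj_incl h hX) (conj_incl_le h hXH)).e =
      br k _ ((X.conj (incl Q.stab h)).P.comap (incl Q.stab))
        ⟨_, (descendFixed k A Q.stab _ (le_conj_incl h hX) ⟨_, ha'⟩).2⟩ := by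
    change descendHom k A Q.stab _ _ _ (X.conj (incl Q.stab h)).e = _
    rw [hXa']
    rfl
  refine Pair.ext_of_rep ?_ _ hc (descendFixed k A Q.stab _ (le_conj_incl h hX) ⟨_, ha'⟩).2 hDc hD'
  ext g
  simp [Pair.conj, Pair.descend, Subgroup.mem_pointwise_smul_iff_inv_smul_mem]

end

end

end BrauerPairs

/-! ### The equality `U ⊓ N = Q`, and uniqueness of the pair below. -/

namespace BrauerPairs

/-- A fully faithful functor which is bijective on objects is an isomorphism of categories. -/
theorem isIsomorphism_of_bijective {C D : Type*} [Category C] [Category D] (F : D ⥤ C) [F.Full]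
    [F.Faithful] (hF : Function.Bijective F.obj) : IsIsomorphism F := by
  let o := Equiv.ofBijective F.obj hF
  have ho : ∀ X, F.obj (o.symm X) = X := o.apply_symm_apply
  have ho' : ∀ X, o.symm (F.obj X) = X := o.symm_apply_apply
  let F' : C ⥤ D :=
    { obj := o.symm
      map := fun {X Y} f => F.preimage (eqToHom (ho X) ≫ f ≫ eqToHom (ho Y).symm)
      map_id := fun X => F.map_injective (by simp)
      map_comp := fun f g => F.map_injective (by simp) }
  refine ⟨F', CategoryTheory.Functor.ext ho' fun X Y f => F.map_injective ?_,
    CategoryTheory.Functor.ext ho fun X Y f => ?_⟩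
  · simp [F', eqToHom_map]
  · simp [F']

theorem exists_equiv_comap {K G : Type*} [Group K] [Group G] {f : K →* G}
    (hf : Function.Injective f) {P : Subgroup K} {R : Subgroup G} (hP : P = R.comap f)
    (hR : R ≤ f.range) : ∃ e : P ≃* R, ∀ u, (e u : G) = f u := by
  subst hP
  refine ⟨MulEquiv.ofBijective ((f.comp (Subgroup.subtype _)).codRestrict R fun u => u.2)
    ⟨fun u v h => Subtype.ext (hf (congrArg Subtype.val h)), fun r => ?_⟩, fun _ => rfl⟩
  obtain ⟨g, hg⟩ := hR r.2
  exact ⟨⟨g, by rw [Subgroup.mem_comap, hg]; exact r.2⟩, Subtype.ext hg⟩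

theorem le_normalizer_inf {G : Type*} [Group G] (U N : Subgroup G) [N.Normal] :
    U ≤ Subgroup.normalizer ((U ⊓ N : Subgroup G) : Set G) := fun u hu => by
  refine Subgroup.mem_normalizer_iff.2 fun g => ?_
  rw [Subgroup.mem_inf, Subgroup.mem_inf, ← Subgroup.Normal.mem_comm_iff (H := N) inferInstance,
    inv_mul_cancel_left, Subgroup.mul_mem_cancel_right _ (inv_mem hu),
    Subgroup.mul_mem_cancel_left _ hu]

variable {k G A : Type*} [Field k] [Group G] [Finite G] [Ring A] [Algebra k A]
  [MulSemiringAction G A] [SMulCommClass G k A] {p : ℕ}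

/-- If `c ∈ Tr_Q^N(A^Q)` and `Br_R(c) ≠ 0` for a subgroup `R` with `Q ≤ R ≤ N`, then `R = Q`. -/
theorem eq_of_br_ne_zero {N Q R : Subgroup G} {a : A} (ha : a ∈ fixed k A Q) (c : fixed k A R)
    (hc : relTrace Q N a = c) (hQR : Q ≤ R) (hRN : R ≤ N) (hbr : br k A R c ≠ 0) : R = Q := by
  -- Mackey: a coset `yQ` fixed by `R` gives `y⁻¹ R y ≤ Q`, and cardinality concludes. Without fixed
  -- cosets the trace is an equivariant sum over a fixed-point-free `R`-set, so `Br_R` kills it.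
  by_cases hfix : ∃ ω : N ⧸ Q.subgroupOf N, ∀ r : R, Subgroup.inclusion hRN r • ω = ω
  · obtain ⟨ω, hω⟩ := hfix
    induction ω using QuotientGroup.induction_on with
    | H y =>
      have hle : MulAut.conj (y : G)⁻¹ • R ≤ Q := by
        intro x hx
        have h0 : (y : G) * x * (y : G)⁻¹ ∈ R := by
          simpa using Subgroup.mem_pointwise_smul_iff_inv_smul_mem.1 hx
        have h1 : ((Subgroup.inclusion hRN ⟨_, h0⟩ * y : N) : N ⧸ Q.subgroupOf N) = y := hω ⟨_, h0⟩
        have h2 := QuotientGroup.eq.1 h1.symm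
        simpa [Subgroup.mem_subgroupOf, mul_assoc] using h2
      refine (Subgroup.eq_of_le_of_card_ge hQR ?_).symm
      calc Nat.card R = Nat.card (MulAut.conj (y : G)⁻¹ • R : Subgroup G) :=
            Nat.card_congr (Subgroup.equivSMul _ _).toEquiv
        _ ≤ Nat.card Q := Subgroup.card_le_of_le hle
  · push Not at hfix
    let _ : MulAction R (N ⧸ Q.subgroupOf N) := MulAction.compHom _ (Subgroup.inclusion hRN)
    refine absurd (br_eq_zero.2 (sum_mem_brauerIdeal R (Ω := N ⧸ Q.subgroupOf N)
      (fun ω => ((Quotient.out ω : N) : G) • a) (fun g ω => ?_) hfix c hc.symm)) hbr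
    exact smul_out ha (Subgroup.inclusion hRN g) ω

variable [Fact p.Prime] [CharP k p]

/-- If `R ⊴ P` for a `p`-group `P` and `Br_P(c) ≠ 0`, then `Br_R(c) ≠ 0`. -/
theorem br_ne_zero_of_normal (hA : IsPPermutation k G A p) {R P : Subgroup G} (hP : IsPGroup p P)
    (hRP : R ≤ P) (hn : P ≤ Subgroup.normalizer (R : Set G)) (c : fixed k A P)
    (hc : br k A P c ≠ 0) : br k A R (Subalgebra.inclusion (fixed_anti k A hRP) c) ≠ 0 := by
  have hr : P ≤ (incl (⊤ : Subgroup (Subgroup.normalizer (R : Set G)))).range :=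
    fun x hx => ⟨⟨⟨x, hn hx⟩, trivial⟩, rfl⟩
  intro h0
  apply hc
  -- `A(P)` embeds in `A(R)(P)`, where the image of `Br_P(c)` is computed from `Br_R(c)`.
  refine descendHom_injective hA hP hRP hr ?_
  have h1 : descendFixed k A (⊤ : Subgroup (Subgroup.normalizer (R : Set G))) P hRP c = 0 :=
    Subtype.ext h0
  rw [descendHom_br, h1, map_zero, map_zero]

theorem inf_eq_of_isDefectGroup (hA : IsPPermutation k G A p) {N : Subgroup G} [N.Normal]
    {c : fixed k A (⊤ : Subgroup G)} {Q U : Pair k G A} (hU : IsBrauerPair p c U)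
    (hdef : IsDefectGroup k N (c : A) Q.P) (hQU : Q.P ≤ U.P) : U.P ⊓ N = Q.P := by
  obtain ⟨hQN, a, ha, hac⟩ := hdef.prop
  refine eq_of_br_ne_zero ha (Subalgebra.inclusion (fixed_anti k A le_top) c) hac (le_inf hQU hQN)
    inf_le_right ?_
  exact br_ne_zero_of_normal hA hU.1 inf_le_left (le_normalizer_inf U.P N)
    (Subalgebra.inclusion (fixed_anti k A le_top) c) (left_ne_zero_of_mul hU.2.2)

variable [FiniteDimensional k A]

namespace Pair

/-- The block `X.e` is fixed by `Y.P`, so it is an idempotent of the fixed-point algebra in which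
the image of `i` is primitive; the dichotomy applies. This is the input for uniqueness. -/
theorem br_mul_eq_of_le (hA : IsPPermutation k G A p) {X Y : Pair k G A} (hX : IsBlock X.e)
    (hY : Y.e ≠ 0) (hYp : IsPGroup p Y.P) {H : Subgroup (Subgroup.normalizer (X.P : Set G))}
    (hYH : Y.P ≤ (incl H).range) (hXY : X ≤ Y) {i : fixed k A Y.P} (hi : IsPrimitive i)
    (hiY : br k A Y.P i * Y.e ≠ 0) :
    br k A X.P (Subalgebra.inclusion (fixed_anti k A (subgroup_le hXY)) i) * X.e =
      br k A X.P (Subalgebra.inclusion (fixed_anti k A (subgroup_le hXY)) i) := by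
  have hst := fun h hh => smul_eq_of_le hA hX hY hYp hYH hXY h hh
  obtain ⟨hQR, hle⟩ := hXY
  have hiX := hle i hi hiY
  let z : fixed k (BrauerQuotient k A X.P) (Y.P.comap (incl H)) := ⟨X.e, mem_fixed.2 hst⟩
  have hz : IsIdempotentElem z := Subtype.ext hX.isIdempotentElem
  have hj0 : descendFixed k A H Y.P hQR i ≠ 0 := fun h =>
    left_ne_zero_of_mul hiX (congrArg Subtype.val h)
  have hj := hi.map_of_surjective (descendFixed_surjective hA hYp hQR hYH) hj0
  exact congrArg Subtype.val (hj.mul_eq_self hz (Subtype.ext (hX.commute _).symm)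
    fun h => hiX (congrArg Subtype.val h))

/-- For `R` normalizing `Q`, at most one pair `(Q, f)` is contained in `(R, e)`. -/
theorem eq_of_le_of_le (hA : IsPPermutation k G A p) {X X' Y : Pair k G A} (hX : IsBlock X.e)
    (hX' : IsBlock X'.e) (hY : Y.e ≠ 0) (hYp : IsPGroup p Y.P)
    {H : Subgroup (Subgroup.normalizer (X.P : Set G))} (hYH : Y.P ≤ (incl H).range)
    (hXY : X ≤ Y) (hXY' : X' ≤ Y) (hP : X'.P = X.P) : X' = X := by
  obtain ⟨P, f⟩ := X
  obtain ⟨P', f'⟩ := X'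
  dsimp only at hP
  subst hP
  obtain ⟨i, hi, hiY⟩ := Y.exists_primitive hY
  -- Both blocks act as the identity on the nonzero element `Br_Q(i)`, so their product is nonzero
  -- and they are equal.
  have h1 := br_mul_eq_of_le hA hX hY hYp hYH hXY hi hiY
  have h2 := br_mul_eq_of_le hA hX' hY hYp hYH hXY' hi hiY
  have h3 := hXY.2 i hi hiY
  dsimp only at h1 h2 h3 hX hX'
  congr 1
  refine hX'.eq_of_mul_ne_zero hX fun h0 => h3 ?_
  rw [← h2, mul_assoc, h0, mul_zero]

omit [FiniteDimensional k A] in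
theorem isBlock_conj {X : Pair k G A} (hX : IsBlock X.e) (x : G) : IsBlock (X.conj x).e := by
  have hc : ∀ g, g ∈ X.P ↔ x * g * x⁻¹ ∈ MulAut.conj x • X.P :=
    fun g => by simp [Subgroup.mem_pointwise_smul_iff_inv_smul_mem, mul_assoc]
  have hd : ∀ g, g ∈ MulAut.conj x • X.P ↔ x⁻¹ * g * x⁻¹⁻¹ ∈ X.P :=
    fun g => by simp [Subgroup.mem_pointwise_smul_iff_inv_smul_mem, mul_assoc]
  refine hX.map (RingEquiv.ofRingHom (conjHom k A x X.P (MulAut.conj x • X.P) hc).toRingHom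
    (conjHom k A x⁻¹ (MulAut.conj x • X.P) X.P hd).toRingHom ?_ ?_)
  · refine RingHom.ext fun u => ?_
    obtain ⟨a, rfl⟩ := br_surjective _ u
    exact congrArg (br k A _) (Subtype.ext (smul_inv_smul x (a : A)))
  · refine RingHom.ext fun u => ?_
    obtain ⟨a, rfl⟩ := br_surjective _ u
    exact congrArg (br k A _) (Subtype.ext (inv_smul_smul x (a : A)))

omit [FiniteDimensional k A] in
theorem mem_range_of_conj_eq {Q : Pair k G A} {x : G} (h : Q.conj x = Q) :
    x ∈ (incl Q.stab).range := by
  have hx : x ∈ Subgroup.normalizer (Q.P : Set G) := by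
    have hP : MulAut.conj x • Q.P = Q.P := congrArg Pair.P h
    refine Subgroup.mem_normalizer_iff.2 fun g => ?_
    conv_rhs => rw [← hP]
    simp [Subgroup.mem_pointwise_smul_iff_inv_smul_mem, mul_assoc]
  refine ⟨⟨⟨x, hx⟩, ?_⟩, rfl⟩
  rw [MulAction.mem_stabilizer_iff]
  obtain ⟨a, ha, hQ⟩ := Q.exists_rep
  obtain h1 := conj_rep x Q a ha hQ
  rw [h] at h1
  obtain ⟨h1, h2⟩ := h1
  conv_rhs => rw [h2]
  rw [hQ, smul_br]
  rfl

/-- If `(Q, f)` is contained in `(R, e)` and in `(S, e')` and `R ∩ N = Q = S ∩ N` with `N` normal,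
then every `x` with `ˣ(R, e) ≤ (S, e')` stabilizes `(Q, f)`. -/
theorem mem_range_of_conj_le (hA : IsPPermutation k G A p) {N : Subgroup G} [N.Normal]
    {Q X Y : Pair k G A} (hQ : IsBlock Q.e) (hQN : Q.P ≤ N) (hY : Y.e ≠ 0)
    (hYp : IsPGroup p Y.P) (hYN : Y.P ⊓ N = Q.P) (hYH : Y.P ≤ (incl Q.stab).range)
    (hQX : Q ≤ X) (hQY : Q ≤ Y) {x : G} (hx : X.conj x ≤ Y) : x ∈ (incl Q.stab).range := by
  have h1 : Q.conj x ≤ Y := le_trans (conj_le_conj x hQX) hx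
  refine mem_range_of_conj_eq (eq_of_le_of_le hA hQ (isBlock_conj hQ x) hY hYp hYH hQY h1 ?_)
  -- Normality of `N` keeps the conjugate of `Q` inside `Y.P ⊓ N = Q`; equality follows by
  -- cardinality.
  have h2 : (Q.conj x).P ≤ Q.P := by
    rw [← hYN]
    refine le_inf (subgroup_le h1) ?_
    change MulAut.conj x • Q.P ≤ N
    rw [← Subgroup.Normal.conj_smul_eq_self x N]
    exact Subgroup.pointwise_smul_le_pointwise_smul_iff.2 hQN
  refine Subgroup.eq_of_le_of_card_ge h2 ?_
  exact (Nat.card_congr (Subgroup.equivSMul (MulAut.conj x) Q.P).toEquiv).le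

end Pair

end BrauerPairs

/-! ### Comparison of the two fusion systems. -/

namespace BrauerPairs

variable {k G A : Type*} [Field k] [Group G] [Finite G] [Ring A] [Algebra k A]
  [FiniteDimensional k A] [MulSemiringAction G A] [SMulCommClass G k A] {p : ℕ}
  [Fact p.Prime] [CharP k p]

/-- The group homomorphisms underlying the morphisms of the two fusion systems coincide. -/
theorem exists_conj_le_iff (hA : IsPPermutation k G A p) {Q X Y : Pair k G A}
    {X' Y' : Pair k Q.stab (BrauerQuotient k A Q.P)}
    (hYp : IsPGroup p Y.P) (hX : Q.P ≤ X.P) (hXH : X.P ≤ (incl Q.stab).range) (hY : Q.P ≤ Y.P)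
    (hYH : Y.P ≤ (incl Q.stab).range) (hX' : X' = X.descend Q hX hXH)
    (hY' : Y' = Y.descend Q hY hYH) (hst : ∀ x : G, X.conj x ≤ Y → x ∈ (incl Q.stab).range)
    {eX : X'.P ≃* X.P} (heX : ∀ u, (eX u : G) = incl Q.stab u)
    {eY : Y'.P ≃* Y.P} (heY : ∀ u, (eY u : G) = incl Q.stab u) (f : X'.P →* Y'.P) :
    (∃ h : Q.stab, X'.conj h ≤ Y' ∧ ∀ u : X'.P, (f u : Q.stab) = h * u * h⁻¹) ↔
      ∃ x : G, X.conj x ≤ Y ∧ ∀ u : X.P, (eY (f (eX.symm u)) : G) = x * u * x⁻¹ := by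
  have hle : ∀ h : Q.stab, X'.conj h ≤ Y' ↔ X.conj (incl Q.stab h) ≤ Y := by
    intro h
    rw [hX', hY', Pair.conj_descend, Pair.descend_le_descend_iff hA hYp]
  have hval : ∀ (h : Q.stab) (u : X'.P), (f u : Q.stab) = h * u * h⁻¹ ↔
      (eY (f (eX.symm (eX u))) : G) = incl Q.stab h * eX u * (incl Q.stab h)⁻¹ := by
    intro h u
    rw [eX.symm_apply_apply, heX, heY, ← map_inv, ← map_mul, ← map_mul]
    exact incl_injective.eq_iff.symm
  constructor
  · rintro ⟨h, h1, h2⟩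
    refine ⟨incl Q.stab h, (hle h).1 h1, fun u => ?_⟩
    obtain ⟨u, rfl⟩ := eX.surjective u
    exact (hval h u).1 (h2 u)
  · rintro ⟨x, h1, h2⟩
    -- The only place where fusion in `G` has to be realized by an element of `H`.
    obtain ⟨h, rfl⟩ := hst x h1
    exact ⟨h, (hle h).2 h1, fun u => (hval h u).2 (h2 _)⟩

/-- Descent is a bijection on objects, and the hom-sets match through `exists_conj_le_iff`, so the
functor is fully faithful and bijective on objects. The hypothesis `hst` isolates what the defect
group contributes: conjugations between pairs above `Q` come from `H`. -/
theorem exists_isomorphism (hA : IsPPermutation k G A p) {c : fixed k A (⊤ : Subgroup G)}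
    {Q U : Pair k G A} (hQ : IsBlock Q.e)
    (hcQ : br k A Q.P (Subalgebra.inclusion (fixed_anti k A le_top) c) * Q.e = Q.e)
    (hUp : IsPGroup p U.P) (hQU : Q.P ≤ U.P) (hUH : U.P ≤ (incl Q.stab).range)
    (hst : ∀ X Y : Pair k G A, IsBrauerPair p c Y → Y ≤ U → Q ≤ X → Q ≤ Y → ∀ x : G,
      X.conj x ≤ Y → x ∈ (incl Q.stab).range) :
    ∃ F : FusionSystem.Above p Q.fixedElt (U.descend Q hQU hUH) (Q.descend Q le_rfl Q.le_stab) ⥤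
      FusionSystem.Above p c U Q, IsIdentityFunctor F ∧ IsIsomorphism F := by
  have hobj : ∀ X : FusionSystem.Above p Q.fixedElt (U.descend Q hQU hUH)
      (Q.descend Q le_rfl Q.le_stab), ∃ (Y : FusionSystem.Above p c U Q) (h₁ : Q.P ≤ Y.obj.pair.P)
        (h₂ : Y.obj.pair.P ≤ (incl Q.stab).range), X.obj.pair = Y.obj.pair.descend Q h₁ h₂ := by
    rintro ⟨⟨X, hX, hXU⟩, hQX⟩
    obtain ⟨Y, h₁, h₂, rfl⟩ := Pair.exists_descend_eq hA X hX.1 (Pair.subgroup_le hQX)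
    obtain ⟨hY, hQY⟩ := (Pair.isBrauerPair_descend_iff hA hQ hcQ h₁ h₂).1 hX
    exact ⟨⟨⟨Y, hY, (Pair.descend_le_descend_iff hA hUp h₁ h₂ hQU hUH).1 hXU⟩, hQY⟩, h₁, h₂, rfl⟩
  -- The chosen preimage is in fact unique, by `Pair.descend_injective`; surjectivity on objects
  -- relies on this.
  choose o h₁ h₂ ho using hobj
  choose e he using fun X => exists_equiv_comap incl_injective (congrArg Pair.P (ho X)) (h₂ X)
  have hiff := fun X Y => exists_conj_le_iff hA (o Y).obj.isBrauerPair.1 (h₁ X) (h₂ X) (h₁ Y) (h₂ Y)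
    (ho X) (ho Y) (hst (o X).obj.pair (o Y).obj.pair (o Y).obj.isBrauerPair (o Y).obj.le
      (o X).property (o Y).property) (he X) (he Y)
  let F : FusionSystem.Above p Q.fixedElt (U.descend Q hQU hUH)
      (Q.descend Q le_rfl Q.le_stab) ⥤ FusionSystem.Above p c U Q :=
    { obj := o
      map := fun {X Y} f => ObjectProperty.homMk
        ⟨(e Y).toMonoidHom.comp (f.hom.1.comp (e X).symm.toMonoidHom), (hiff X Y f.hom.1).1 f.hom.2⟩
      map_id := fun X => ObjectProperty.hom_ext _ (Subtype.ext (MonoidHom.ext fun u =>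
        (e X).apply_symm_apply u))
      map_comp := fun {X Y Z} f g => ObjectProperty.hom_ext _ (Subtype.ext (MonoidHom.ext fun u =>
        congrArg (fun v => e Z (g.hom.1 v)) ((e Y).symm_apply_apply _).symm)) }
  have hmap : ∀ {X Y} (f : X ⟶ Y) (u : (o X).obj.pair.P),
      (F.map f).hom.1 u = e Y (f.hom.1 ((e X).symm u)) := fun _ _ => rfl
  have hfaithful : F.Faithful := ⟨fun {X Y f g} h => ObjectProperty.hom_ext _ (Subtype.ext
    (MonoidHom.ext fun u => (e Y).injective (by
      have h3 := hmap f (e X u)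
      rw [h, hmap g, (e X).symm_apply_apply] at h3
      exact h3.symm)))⟩
  have hfull : F.Full := ⟨fun {X Y} f => by
    let g : X.obj.pair.P →* Y.obj.pair.P :=
      (e Y).symm.toMonoidHom.comp (f.hom.1.comp (e X).toMonoidHom)
    have hg : ∀ u, e Y (g ((e X).symm u)) = f.hom.1 u := fun u => by
      change e Y ((e Y).symm (f.hom.1 (e X ((e X).symm u)))) = f.hom.1 u
      rw [(e Y).apply_symm_apply, (e X).apply_symm_apply]
    refine ⟨ObjectProperty.homMk ⟨g, (hiff X Y g).2 ?_⟩, ?_⟩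
    · simp only [hg]
      exact f.hom.2
    · exact ObjectProperty.hom_ext _ (Subtype.ext (MonoidHom.ext hg))⟩
  refine ⟨F, ⟨fun X => ⟨h₁ X, h₂ X, ho X⟩, fun {X Y} f u v huv => ?_⟩,
    isIsomorphism_of_bijective F ⟨fun X Y hXY => ?_, fun X => ?_⟩⟩
  · have hv : v = e X u := Subtype.ext (huv.trans (he X u).symm)
    rw [hv, hmap, (e X).symm_apply_apply, he]
  · have hXY' : X.obj.pair = Y.obj.pair := by
      have hpair : (o X).obj.pair = (o Y).obj.pair :=
        congrArg (fun Z : FusionSystem.Above p c U Q => Z.obj.pair) hXY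
      rw [ho X, ho Y]
      congr 1
    obtain ⟨⟨X, _, _⟩, _⟩ := X
    obtain ⟨⟨Y, _, _⟩, _⟩ := Y
    dsimp only at hXY'
    subst hXY'
    rfl
  · obtain ⟨⟨X, hX, hXU⟩, hQX⟩ := X
    have hX₁ := Pair.subgroup_le hQX
    have hX₂ := (Pair.subgroup_le hXU).trans hUH
    let Z : FusionSystem.Above p Q.fixedElt (U.descend Q hQU hUH)
        (Q.descend Q le_rfl Q.le_stab) :=
      ⟨⟨X.descend Q hX₁ hX₂, (Pair.isBrauerPair_descend_iff hA hQ hcQ hX₁ hX₂).2 ⟨hX, hQX⟩,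
        (Pair.descend_le_descend_iff hA hUp hX₁ hX₂ hQU hUH).2 hXU⟩,
        (Pair.descend_le_descend_iff hA hX.1 le_rfl Q.le_stab hX₁ hX₂).2 hQX⟩
    have hZ : X = (o Z).obj.pair :=
      Pair.descend_injective hA hX.1 hX₁ hX₂ (h₁ Z) (h₂ Z) (ho Z)
    refine ⟨Z, ?_⟩
    change o Z = _
    generalize o Z = W at hZ
    obtain ⟨⟨W, _, _⟩, _⟩ := W
    dsimp only at hZ
    subst hZ
    rfl

end BrauerPairs

theorem theorem3p9 {k G A : Type*} [Field k] (p : ℕ) [Fact p.Prime] [CharP k p]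
    [Group G] [Finite G] (N : Subgroup G) [N.Normal]
    [Ring A] [Algebra k A] [FiniteDimensional k A] [MulSemiringAction G A] [SMulCommClass G k A]
    (hA : IsPPermutation k G A p) (φ : InteriorStructure A N)
    (c : fixed k A (⊤ : Subgroup G)) (hc : IsPrimitiveIn (fixed k A N) (c : A))
    (Q U : Pair k G A)
    (hQ : IsBrauerPair p c Q) (hdef : IsDefectGroup k N (c : A) Q.P)
    (hprim : IsPrimitiveIn
      (fixed k (BrauerQuotient k A Q.P)
        ((Subgroup.centralizer (Q.P : Set G) ⊓ N).subgroupOf (Subgroup.normalizer (Q.P : Set G))))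
      Q.e)
    (hU : IsMaximalBrauerPair p c U) (hQU : Q ≤ U) :
    ∃ hUH : U.P ≤ (incl Q.stab).range,
      IsMaximalBrauerPair p Q.fixedElt (U.descend Q (Pair.subgroup_le hQU) hUH) ∧
      ∃ F : FusionSystem.Above p Q.fixedElt (U.descend Q (Pair.subgroup_le hQU) hUH)
          (Q.descend Q le_rfl Q.le_stab) ⥤ FusionSystem.Above p c U Q,
        IsIdentityFunctor F ∧ IsIsomorphism F := by
  have hUp := hU.1.1
  have hQU' := Pair.subgroup_le hQU
  have hQN : Q.P ≤ N := hdef.prop.1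
  have hinf : U.P ⊓ N = Q.P := inf_eq_of_isDefectGroup hA hU.1 hdef hQU'
  have hnorm : U.P ≤ Subgroup.normalizer (Q.P : Set G) := by
    have h := le_normalizer_inf U.P N
    rwa [hinf] at h
  -- `U` is already known to normalize `Q`, so `Pair.smul_eq_of_le` applies with the whole
  -- normalizer as acting group.
  have hUH : U.P ≤ (incl Q.stab).range := by
    intro u hu
    have h := Pair.smul_eq_of_le hA hQ.2.1 hU.1.2.1.ne_zero hUp
      (H := (⊤ : Subgroup (Subgroup.normalizer (Q.P : Set G))))
      (fun x hx => ⟨⟨⟨x, hnorm hx⟩, trivial⟩, rfl⟩) hQU ⟨⟨u, hnorm hu⟩, trivial⟩ hu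
    exact ⟨⟨⟨u, hnorm hu⟩, h⟩, rfl⟩
  -- `Br_Q(c)` need not be central in `A(Q)`, so `f_Q` being a block does not suffice. Primitivity
  -- of `f_Q` in the fixed points of `C_N(Q)`, an algebra that contains `Br_Q(c)`, gives the
  -- dichotomy.
  have hcQ : br k A Q.P (Subalgebra.inclusion (fixed_anti k A le_top) c) * Q.e = Q.e := by
    obtain ⟨hmem, hpr⟩ := hprim
    obtain ⟨_, hcp⟩ := hc
    have hcc : (c : A) * c = c := congrArg Subtype.val hcp.1
    have hci : IsIdempotentElem c := Subtype.ext hcc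
    let z := br k A Q.P (Subalgebra.inclusion (fixed_anti k A le_top) c)
    have hz : z ∈ fixed k (BrauerQuotient k A Q.P)
        ((Subgroup.centralizer (Q.P : Set G) ⊓ N).subgroupOf
          (Subgroup.normalizer (Q.P : Set G))) := by
      refine mem_fixed.2 fun g _ => ?_
      exact congrArg (br k A Q.P) (Subtype.ext (mem_fixed.1 c.2 (g : G) trivial))
    have hzi : IsIdempotentElem z :=
      hci.map ((br k A Q.P).comp (Subalgebra.inclusion (fixed_anti k A le_top)))
    have hzi' : IsIdempotentElem (⟨z, hz⟩ : fixed k (BrauerQuotient k A Q.P)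
        ((Subgroup.centralizer (Q.P : Set G) ⊓ N).subgroupOf
          (Subgroup.normalizer (Q.P : Set G)))) := Subtype.ext hzi
    have h := hpr.mul_eq_self hzi' (Subtype.ext (hQ.2.1.commute z)) fun h0 => hQ.2.2 (by
      rw [← (hQ.2.1.commute _).eq]
      exact congrArg Subtype.val h0)
    rw [← (hQ.2.1.commute _).eq]
    exact congrArg Subtype.val h
  refine ⟨hUH, ⟨?_, fun Y hY hUY => ?_⟩, ?_⟩
  · exact (Pair.isBrauerPair_descend_iff hA hQ.2.1 hcQ hQU' hUH).2 ⟨hU.1, hQU⟩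
  -- A pair for `A(Q)` above `U` contains `Q`, so it descends from a pair for `A` above `U`, and
  -- that pair is `U` by maximality.
  · obtain ⟨X, h₁, h₂, rfl⟩ := Pair.exists_descend_eq hA Y hY.1
      ((Subgroup.comap_mono hQU').trans (Pair.subgroup_le hUY))
    obtain ⟨hX, -⟩ := (Pair.isBrauerPair_descend_iff hA hQ.2.1 hcQ h₁ h₂).1 hY
    have hXU := hU.2 X hX ((Pair.descend_le_descend_iff hA hX.1 hQU' hUH h₁ h₂).1 hUY)
    subst hXU
    rfl
  · refine exists_isomorphism hA hQ.2.1 hcQ hUp hQU' hUH fun X Y hY hYU hQX hQY x hx => ?_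
    -- The intersection of `Y` with `N` is squeezed between `Q` and `U ⊓ N = Q`.
    refine Pair.mem_range_of_conj_le hA (N := N) hQ.2.1 hQN hY.2.1.ne_zero hY.1
      (le_antisymm ?_ (le_inf (Pair.subgroup_le hQY) hQN))
      ((Pair.subgroup_le hYU).trans hUH) hQX hQY hx
    rw [← hinf]
    exact inf_le_inf_right N (Pair.subgroup_le hYU)
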